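/- Let $n\ge 1$. Let $\mathrm{Bir}(\mathbb P^n_{\mathbb C})$ be the group of birational self-maps of $\mathbb P^n_{\mathbb C}$, let $\sigma_n=\big(\prod_{i\neq 0}z_i:\prod_{i\neq 1}z_i:\ldots:\prod_{i\neq n}z_i\big)$ be the standard involution, identify $\mathrm{Aut}(\mathbb P^n_{\mathbb C})$ with $\mathrm{PGL}(n+1,\mathbb C)\subset \mathrm{Bir}(\mathbb P^n_{\mathbb C})$, and let $G_n(\mathbb C)=\langle\sigma_n,\mathrm{Aut}(\mathbb P^n_{\mathbb C})\rangle\subset\mathrm{Bir}(\mathbb P^n_{\mathbb C})$. Let $\mathrm{Tame}_n$ be the group of polynomial automorphisms of $\mathbb C^n$ generated by the affine automorphisms (all coordinates of degree at most $1$) and the Jonquières automorphisms (those $(\phi_0,\ldots,\phi_{n-1})$ where $\phi_i$ depends only on $z_i,\ldots,z_{n-1}$ for each $i$). (1) $\mathrm{Tame}_n$ is a subgroup of $G_n(\mathbb C)$: there is an injective group homomorphism $\iota\colon\mathrm{Tame}_n\to G_n(\mathbb C)$ such that, for each $f\in\mathrm{Tame}_n$, the birational map $\iota(f)$ is defined at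 every point of the affine chart $\mathbb C^n\subset\mathbb P^n_{\mathbb C}$, $(z_0,\ldots,z_{n-1})\mapsto(z_0:\ldots:z_{n-1}:1)$, and coincides with $f$ there. (2) Let $k\ge 0$. For generic $(\mathfrak g_0,\ldots,\mathfrak g_k)\in\mathrm{Aut}(\mathbb P^n_{\mathbb C})^{k+1}$, the group $\langle \mathfrak g_0,\ldots,\mathfrak g_k,\sigma_n\rangle$ is the free product \[ \underbrace{\mathbb Z*\cdots*\mathbb Z}_{k+1}*\,(\mathbb Z/2\mathbb Z), \] the elements $\mathfrak g_0,\ldots,\mathfrak g_k$ and $\sigma_n$ being the generators of the factors. In particular, the subgroup $\langle \mathfrak g_0\sigma_n,\ldots,\mathfrak g_k\sigma_n\rangle$ of $G_n(\mathbb C)$ is free, with basis $\mathfrak g_0\sigma_n,\ldots,\mathfrak g_k\sigma_n$. Here "for generic" means: for all tuples outside some countable union of proper Zariski closed subsets of $\mathrm{Aut}(\mathbb P^n_{\mathbb C})^{k+1}$, the complement of this union being dense for the Euclidean topology. -/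

import Mathlib

noncomputable section

namespace Cremona

open MvPolynomial

/-- Homogeneous coordinate polynomials of a rational self-map of complex projective `n`-space:
`n + 1` homogeneous polynomials of the same positive degree. Common factors are allowed here;
they are removed by the equivalence relation `Tuple.Equiv` below. -/
structure Tuple (n : ℕ) where
  /-- the coordinate polynomials -/
  poly : Fin (n + 1) → MvPolynomial (Fin (n + 1)) ℂ
  /-- their common degree -/
  deg : ℕ
  deg_pos : 0 < deg
  homog : ∀ i, (poly i).IsHomogeneous deg

/-- `F.IsLeftInv G`: the composite `F ∘ G` is the identity rational map, that is,
`F_i (G_0, …, G_n) = h * X_i` for all `i`, with a common factor `h ≠ 0`. -/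
def Tuple.IsLeftInv {n : ℕ} (F G : Tuple n) : Prop :=
  ∃ h : MvPolynomial (Fin (n + 1)) ℂ, h ≠ 0 ∧ ∀ i, aeval G.poly (F.poly i) = h * X i

/-- Tuples that define a birational map: those with a rational inverse. -/
def BirTuple (n : ℕ) : Type :=
  {F : Tuple n // ∃ G : Tuple n, F.IsLeftInv G ∧ G.IsLeftInv F}

variable {n : ℕ}

lemma aeval_mul_family {d : ℕ} {p : MvPolynomial (Fin (n + 1)) ℂ} (hp : p.IsHomogeneous d)
    (c : MvPolynomial (Fin (n + 1)) ℂ) (v : Fin (n + 1) → MvPolynomial (Fin (n + 1)) ℂ) :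
    aeval (fun i => c * v i) p = c ^ d * aeval v p := by
  rw [aeval_def, aeval_def, eval₂_eq, eval₂_eq, Finset.mul_sum]
  refine Finset.sum_congr rfl fun s hs => ?_
  have hd : ∑ i ∈ s.support, s i = d := (hp.degree_eq_sum_deg_support hs).symm
  rw [← hd]
  simp only [mul_pow, Finset.prod_mul_distrib, Finset.prod_pow_eq_pow_sum]
  ring

lemma aeval_comp_apply (F G : Tuple n) (p : MvPolynomial (Fin (n + 1)) ℂ) :
    aeval (fun i => aeval G.poly (F.poly i)) p = aeval G.poly (aeval F.poly p) :=
  (comp_aeval_apply F.poly (aeval G.poly) p).symm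

/-- The composite `F ∘ G` of two tuples, by substitution. -/
def Tuple.comp (F G : Tuple n) : Tuple n where
  poly i := aeval G.poly (F.poly i)
  deg := G.deg * F.deg
  deg_pos := Nat.mul_pos G.deg_pos F.deg_pos
  homog i := (F.homog i).aeval G.poly G.homog

/-- A homogeneous polynomial is not killed by substituting a tuple with a right inverse. -/
lemma eq_zero_of_aeval_eq_zero {F G : Tuple n} (hFG : F.IsLeftInv G) {d : ℕ}
    {p : MvPolynomial (Fin (n + 1)) ℂ} (hp : p.IsHomogeneous d) (h0 : aeval F.poly p = 0) :
    p = 0 := by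
  obtain ⟨h, hne, hh⟩ := hFG
  have h1 := aeval_comp_apply F G p
  rw [h0, map_zero] at h1
  have h2 : aeval (fun i => h * X i) p = h ^ d * p := by
    rw [aeval_mul_family hp, aeval_X_left_apply]
  rw [funext hh, h2] at h1
  exact (mul_eq_zero.1 h1).resolve_left (pow_ne_zero _ hne)

lemma isLeftInv_comp {F F' G G' : Tuple n} (h1 : F.IsLeftInv F') (h1' : F'.IsLeftInv F)
    (h2 : G.IsLeftInv G') : (F.comp G).IsLeftInv (G'.comp F') := by
  obtain ⟨h, hne, hh⟩ := h1
  obtain ⟨k, kne, hk⟩ := h2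
  -- `F (G (G' (F'))) = F (k(F') * F') = k(F') ^ d * F (F')`
  have key : ∀ i, aeval (G'.comp F').poly ((F.comp G).poly i) =
      ((aeval F'.poly k) ^ F.deg * h) * X i := by
    intro i
    have e1 : ∀ j, aeval (G'.comp F').poly (G.poly j) = aeval F'.poly k * F'.poly j := by
      intro j
      have := aeval_comp_apply G' F' (G.poly j)
      rw [hk j, map_mul, aeval_X] at this
      exact this
    have e2 := aeval_comp_apply G (G'.comp F') (F.poly i)
    rw [funext e1, aeval_mul_family (F.homog i), hh i] at e2
    rw [mul_assoc]
    exact e2.symm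
  refine ⟨_, mul_ne_zero (pow_ne_zero _ ?_) hne, key⟩
  intro h0
  have hz : aeval F'.poly (k * X 0) = 0 := by rw [map_mul, h0, zero_mul]
  have hom : (k * X 0 : MvPolynomial (Fin (n + 1)) ℂ).IsHomogeneous (G'.deg * G.deg) := by
    rw [← hk 0]
    exact (G.homog 0).aeval G'.poly G'.homog
  exact mul_ne_zero kne (X_ne_zero 0) (eq_zero_of_aeval_eq_zero h1' hom hz)

lemma Tuple.IsLeftInv.exists_ne_zero {F G : Tuple n} (h : F.IsLeftInv G) :
    ∃ k, F.poly k ≠ 0 := by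
  obtain ⟨h, hne, hh⟩ := h
  refine ⟨0, fun h0 => ?_⟩
  have := hh 0
  rw [h0, map_zero] at this
  exact mul_ne_zero hne (X_ne_zero 0) this.symm

lemma BirTuple.exists_ne_zero (F : BirTuple n) : ∃ k, F.1.poly k ≠ 0 := by
  obtain ⟨G, h, -⟩ := F.2
  exact h.exists_ne_zero

/-- Two tuples define the same rational map iff they are proportional over the field of
rational functions. -/
def Tuple.Equiv (F G : Tuple n) : Prop :=
  ∀ i j, F.poly i * G.poly j = F.poly j * G.poly i

lemma proportional_trans {F G H : Tuple n} {k : Fin (n + 1)} (hk : G.poly k ≠ 0)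
    (h1 : F.Equiv G) (h2 : G.Equiv H) : F.Equiv H := by
  intro i j
  refine mul_right_cancel₀ hk ?_
  linear_combination H.poly j * h1 i k + F.poly k * h2 i j - H.poly i * h1 j k

instance birSetoid (n : ℕ) : Setoid (BirTuple n) where
  r F G := F.1.Equiv G.1
  iseqv :=
    { refl := fun _ _ _ => mul_comm _ _
      symm := fun h i j => by linear_combination - h i j
      trans := fun {_ G _} h1 h2 => by
        obtain ⟨k, hk⟩ := G.exists_ne_zero
        exact proportional_trans hk h1 h2 }

/-- Birational self-maps of `ℙⁿ` over `ℂ`. -/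
def Bir (n : ℕ) : Type := Quotient (birSetoid n)

/-- The birational map defined by a tuple. -/
def Bir.mk (F : BirTuple n) : Bir n := Quotient.mk _ F

/-- Composition of representatives. -/
def BirTuple.comp (F G : BirTuple n) : BirTuple n :=
  ⟨F.1.comp G.1, by
    obtain ⟨F', hF, hF'⟩ := F.2
    obtain ⟨G', hG, hG'⟩ := G.2
    exact ⟨G'.comp F', isLeftInv_comp hF hF' hG, isLeftInv_comp hG' hG hF'⟩⟩

lemma comp_equiv {F F' G G' : BirTuple n} (hF : F.1.Equiv F'.1) (hG : G.1.Equiv G'.1) :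
    (F.comp G).1.Equiv (F'.comp G').1 := by
  have h1 : (F.comp G).1.Equiv (F'.comp G).1 := by
    intro i j
    have := congrArg (aeval G.1.poly) (hF i j)
    rw [map_mul, map_mul] at this
    exact this
  have h2 : (F'.comp G).1.Equiv (F'.comp G').1 := by
    intro i j
    obtain ⟨k, hk⟩ := G.exists_ne_zero
    obtain ⟨l, hl⟩ := G'.exists_ne_zero
    have hk' : G'.1.poly k ≠ 0 := by
      intro h0
      have := hG k l
      rw [h0, mul_zero] at this
      exact mul_ne_zero hk hl this
    have e : ∀ i, (G.1.poly k) ^ F'.1.deg * aeval G'.1.poly (F'.1.poly i) =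
        (G'.1.poly k) ^ F'.1.deg * aeval G.1.poly (F'.1.poly i) := by
      intro i
      rw [← aeval_mul_family (F'.1.homog i), ← aeval_mul_family (F'.1.homog i)]
      congr 2
      funext j
      rw [hG k j, mul_comm]
    change aeval G.1.poly (F'.1.poly i) * aeval G'.1.poly (F'.1.poly j) =
      aeval G.1.poly (F'.1.poly j) * aeval G'.1.poly (F'.1.poly i)
    refine mul_left_cancel₀ (pow_ne_zero F'.1.deg hk) ?_
    linear_combination aeval G.1.poly (F'.1.poly i) * e j - aeval G.1.poly (F'.1.poly j) * e i
  obtain ⟨k, hk⟩ := (F'.comp G).exists_ne_zero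
  exact proportional_trans hk h1 h2

/-- The identity tuple `(X_0 : … : X_n)`. -/
def Tuple.id (n : ℕ) : Tuple n where
  poly := X
  deg := 1
  deg_pos := one_pos
  homog i := isHomogeneous_X ℂ i

lemma id_isLeftInv : (Tuple.id n).IsLeftInv (Tuple.id n) :=
  ⟨1, one_ne_zero, fun i => by simp [Tuple.id]⟩

/-- `φ * ψ` is the composite `φ ∘ ψ`. -/
instance birMonoid (n : ℕ) : Monoid (Bir n) where
  mul := Quotient.map₂ BirTuple.comp fun _ _ hF _ _ hG => comp_equiv hF hG
  one := Bir.mk ⟨Tuple.id n, Tuple.id n, id_isLeftInv, id_isLeftInv⟩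
  mul_assoc := by
    rintro ⟨F⟩ ⟨G⟩ ⟨H⟩
    refine Quotient.sound fun i j => ?_
    have h : ∀ i, ((F.comp G).comp H).1.poly i = (F.comp (G.comp H)).1.poly i := fun i =>
      (aeval_comp_apply G.1 H.1 (F.1.poly i)).symm
    rw [h, h, mul_comm]
  one_mul := by
    rintro ⟨F⟩
    refine Quotient.sound fun i j => ?_
    change aeval F.1.poly (X i) * F.1.poly j = aeval F.1.poly (X j) * F.1.poly i
    rw [aeval_X, aeval_X, mul_comm]
  mul_one := by
    rintro ⟨F⟩
    refine Quotient.sound fun i j => ?_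
    change aeval X (F.1.poly i) * F.1.poly j = aeval X (F.1.poly j) * F.1.poly i
    rw [aeval_X_left_apply, aeval_X_left_apply, mul_comm]

lemma mk_mul_mk_eq_one {F G : BirTuple n} (h : F.1.IsLeftInv G.1) :
    Bir.mk F * Bir.mk G = 1 := by
  obtain ⟨k, -, hk⟩ := h
  refine Quotient.sound fun i j => ?_
  change aeval G.1.poly (F.1.poly i) * X j = aeval G.1.poly (F.1.poly j) * X i
  rw [hk, hk]
  exact mul_right_comm _ _ _

/-- The Cremona group: birational self-maps of `ℙⁿ` under composition. -/
instance birGroup (n : ℕ) : Group (Bir n) :=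
  groupOfIsUnit <| by
    rintro ⟨F⟩
    obtain ⟨G, h1, h2⟩ := F.2
    exact ⟨⟨Bir.mk F, Bir.mk ⟨G, F.1, h2, h1⟩, mk_mul_mk_eq_one h1, mk_mul_mk_eq_one h2⟩, rfl⟩

/-- The coordinate polynomials `∏_{j ≠ i} X_j` of the standard involution. -/
def sigmaTuple (n : ℕ) [NeZero n] : Tuple n where
  poly i := ∏ j ∈ Finset.univ.erase i, X j
  deg := n
  deg_pos := NeZero.pos n
  homog i := by
    have := IsHomogeneous.prod (R := ℂ) (Finset.univ.erase i)
      (fun j : Fin (n + 1) => (X j : MvPolynomial (Fin (n + 1)) ℂ)) (fun _ => 1)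
      (fun j _ => isHomogeneous_X ℂ j)
    simpa using this

lemma sigma_isLeftInv (n : ℕ) [NeZero n] : (sigmaTuple n).IsLeftInv (sigmaTuple n) := by
  refine ⟨(∏ j, X j) ^ (n - 1), pow_ne_zero _ (Finset.prod_ne_zero_iff.2 fun j _ => X_ne_zero j),
    fun i => ?_⟩
  have hS : (∏ j ∈ Finset.univ.erase i, X j : MvPolynomial (Fin (n + 1)) ℂ) ≠ 0 :=
    Finset.prod_ne_zero_iff.2 fun j _ => X_ne_zero j
  refine mul_right_cancel₀ hS ?_
  have hP : ∀ j : Fin (n + 1), (sigmaTuple n).poly j * X j = ∏ l, X l := fun j =>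
    Finset.prod_erase_mul _ _ (Finset.mem_univ j)
  calc aeval (sigmaTuple n).poly ((sigmaTuple n).poly i) * ∏ j ∈ Finset.univ.erase i, X j
      = ∏ j ∈ Finset.univ.erase i, ((sigmaTuple n).poly j * X j) := by
        rw [Finset.prod_mul_distrib]
        congr 1
        change aeval (sigmaTuple n).poly (∏ j ∈ Finset.univ.erase i, X j) = _
        rw [map_prod]
        simp only [aeval_X]
    _ = (∏ l, X l) ^ n := by
        rw [Finset.prod_congr rfl fun j _ => hP j, Finset.prod_const]
        simp
    _ = (∏ l, X l) ^ (n - 1) * ∏ l, X l := by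
        rw [← pow_succ, Nat.sub_add_cancel (NeZero.pos n)]
    _ = (∏ j, X j) ^ (n - 1) * X i * ∏ j ∈ Finset.univ.erase i, X j := by
        rw [← Finset.mul_prod_erase Finset.univ _ (Finset.mem_univ i)]
        ring

/-- The standard involution `σ_n`. -/
def sigma (n : ℕ) [NeZero n] : Bir n :=
  Bir.mk ⟨sigmaTuple n, sigmaTuple n, sigma_isLeftInv n, sigma_isLeftInv n⟩

/-- The automorphism group of `ℙⁿ`, that is, `PGL(n + 1, ℂ)`. -/
abbrev AutP (n : ℕ) : Type := Matrix.ProjGenLinGroup (Fin (n + 1)) ℂ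

/-- The linear forms `∑ j, A i j X_j`. -/
def linTuple (A : GL (Fin (n + 1)) ℂ) : Tuple n where
  poly i := ∑ j, C (A.1 i j) * X j
  deg := 1
  deg_pos := one_pos
  homog i := IsHomogeneous.sum _ _ _ fun j _ => isHomogeneous_C_mul_X _ _

lemma linTuple_comp (A B : GL (Fin (n + 1)) ℂ) (i : Fin (n + 1)) :
    aeval (linTuple B).poly ((linTuple A).poly i) = (linTuple (A * B)).poly i := by
  simp only [linTuple, map_sum, map_mul, aeval_X, Units.val_mul, Matrix.mul_apply, algHom_C,
    algebraMap_eq, Finset.mul_sum, Finset.sum_mul]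
  rw [Finset.sum_comm]
  simp only [mul_assoc]

lemma linTuple_one (i : Fin (n + 1)) :
    (linTuple (1 : GL (Fin (n + 1)) ℂ)).poly i = X i := by
  simp [linTuple, Matrix.one_apply]

lemma linTuple_isLeftInv {A B : GL (Fin (n + 1)) ℂ} (h : A * B = 1) :
    (linTuple A).IsLeftInv (linTuple B) :=
  ⟨1, one_ne_zero, fun i => by rw [linTuple_comp, h, linTuple_one, one_mul]⟩

/-- The birational map defined by an invertible matrix. -/
def glToBir (n : ℕ) : GL (Fin (n + 1)) ℂ →* Bir n where
  toFun A := Bir.mk ⟨linTuple A, linTuple A⁻¹, linTuple_isLeftInv (mul_inv_cancel A),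
    linTuple_isLeftInv (inv_mul_cancel A)⟩
  map_one' := Quotient.sound fun i j => by
    change (linTuple 1).poly i * X j = (linTuple 1).poly j * X i
    rw [linTuple_one, linTuple_one, mul_comm]
  map_mul' A B := Quotient.sound fun i j => by
    change (linTuple (A * B)).poly i * aeval (linTuple B).poly ((linTuple A).poly j) =
      (linTuple (A * B)).poly j * aeval (linTuple B).poly ((linTuple A).poly i)
    rw [linTuple_comp, linTuple_comp, mul_comm]

/-- Automorphisms of `ℙⁿ` as birational self-maps. -/
def autToBir (n : ℕ) : AutP n →* Bir n :=
  Matrix.ProjGenLinGroup.lift (glToBir n) <| by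
    ext u
    refine Quotient.sound fun i j => ?_
    change (linTuple (Matrix.GeneralLinearGroup.scalar (Fin (n + 1)) u)).poly i * X j =
      (linTuple (Matrix.GeneralLinearGroup.scalar (Fin (n + 1)) u)).poly j * X i
    have h : ∀ i, (linTuple (Matrix.GeneralLinearGroup.scalar (Fin (n + 1)) u)).poly i =
        C (u : ℂ) * X i := by
      intro i
      simp only [linTuple, Matrix.GeneralLinearGroup.coe_scalar, Matrix.scalar_apply,
        Matrix.diagonal_apply]
      rw [Finset.sum_eq_single i]
      · rw [if_pos rfl]
      · intro b _ hb
        rw [if_neg hb.symm, C_0, zero_mul]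
      · simp
    rw [h, h, mul_right_comm]

/-- The group `G_n(ℂ)` generated by the standard involution and the automorphisms of `ℙⁿ`. -/
def G (n : ℕ) [NeZero n] : Subgroup (Bir n) :=
  Subgroup.closure ({sigma n} ∪ Set.range (autToBir n))

/-- The polynomial self-map of `ℂⁿ` with coordinates `p` is the bijection `f`. -/
def IsGivenBy (f : Equiv.Perm (Fin n → ℂ)) (p : Fin n → MvPolynomial (Fin n) ℂ) : Prop :=
  ∀ x i, f x i = eval x (p i)

/-- Affine automorphisms of `ℂⁿ`: coordinates of degree at most one. -/
def IsAffine (f : Equiv.Perm (Fin n → ℂ)) : Prop :=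
  ∃ p, IsGivenBy f p ∧ ∀ i, (p i).totalDegree ≤ 1

/-- Jonquières automorphisms of `ℂⁿ`: the `i`-th coordinate depends only on
`z_i, …, z_{n-1}`. -/
def IsJonquieres (f : Equiv.Perm (Fin n → ℂ)) : Prop :=
  ∃ p, IsGivenBy f p ∧ ∀ i, p i ∈ supported ℂ (Set.Ici i)

/-- The group of tame polynomial automorphisms of `ℂⁿ`. -/
def Tame (n : ℕ) : Subgroup (Equiv.Perm (Fin n → ℂ)) :=
  Subgroup.closure ({f | IsAffine f} ∪ {f | IsJonquieres f})

/-- `φ` is defined at every point of the affine chart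
`ℂⁿ ⊆ ℙⁿ, z ↦ (z_0 : … : z_{n-1} : 1)`, and coincides there with `f`. -/
def Bir.Extends (φ : Bir n) (f : (Fin n → ℂ) → (Fin n → ℂ)) : Prop :=
  ∃ F : BirTuple n, Bir.mk F = φ ∧ ∀ z : Fin n → ℂ, ∃ c : ℂ, c ≠ 0 ∧
    ∀ i, eval (Fin.snoc z 1 : Fin (n + 1) → ℂ) (F.1.poly i) =
      c * (Fin.snoc (f z) 1 : Fin (n + 1) → ℂ) i

/-- The Euclidean topology of `PGL(n + 1, ℂ)`: the quotient topology from `GL(n + 1, ℂ)`. -/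
instance autTopology (n : ℕ) : TopologicalSpace (AutP n) :=
  TopologicalSpace.coinduced (Matrix.ProjGenLinGroup.mk (n := Fin (n + 1)) (R := ℂ)) inferInstance

/-- Zariski closed subsets of `Aut(ℙⁿ)ᵐ`: those whose preimage in `GL(n + 1, ℂ)ᵐ` is the zero
set of a family of polynomials in the matrix entries. -/
def IsZariskiClosed {m : ℕ} (S : Set (Fin m → AutP n)) : Prop :=
  ∃ I : Set (MvPolynomial (Fin m × Fin (n + 1) × Fin (n + 1)) ℂ),
    ∀ A : Fin m → GL (Fin (n + 1)) ℂ,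
      (fun l => Matrix.ProjGenLinGroup.mk (A l)) ∈ S ↔
        ∀ p ∈ I, eval (fun t => (A t.1).1 t.2.1 t.2.2) p = 0

/-- `P` holds for generic `g ∈ Aut(ℙⁿ)ᵐ`: it holds outside a countable union of proper Zariski
closed subsets, the complement of which is dense in the Euclidean topology. -/
def IsGeneric {m : ℕ} (P : (Fin m → AutP n) → Prop) : Prop :=
  ∃ R : ℕ → Set (Fin m → AutP n), (∀ j, IsZariskiClosed (R j) ∧ R j ≠ Set.univ) ∧
    Dense {g | ∀ j, g ∉ R j} ∧ ∀ g, (∀ j, g ∉ R j) → P g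

end Cremona

end

noncomputable section

namespace Cremona

open MvPolynomial

variable {n : ℕ}

/-! ### Values of birational maps at vectors over an extension field -/

section Points

variable {K : Type*} [Field K] [Algebra ℂ K]

/-! Identities between birational maps are checked at one generic vector. If no nonzero homogeneous
polynomial vanishes at `v`, then `φ` is determined by its value at `v` (`Gen.ext`). The coordinates
of the function field give such a vector (`gen_coord`), so every relation becomes a calculation in a
field.

For the tame group, the main point is that every shear `z_i ↦ z_i + P`, with `P` free of `z_i`, lies
in `G n` (`shear_mem_G`). Two copies of `σ_n` interleaved with transvections invert a single
coordinate, `y_a ↦ -y_b² / y_a`, and two such inversions give `y_a ↦ y_a (y_b / y_c)²`. Hence `z_i ↦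
z_i z_j²` is available, and after conjugation by a translation so is `z_i ↦ z_i (z_j + 1)²`.
Conjugating a shear by these multiplies `P` by `z_j²` or `(z_j + 1)²`. Since `2 z_j = (z_j + 1)² -
z_j² - 1`, all polynomials are reached from the constants. A Jonquières automorphism is a product of
dilations and shears, because a polynomial injective in one variable has degree one in it with
constant leading coefficient. Extensions from the affine chart are unique, which makes the embedding
a homomorphism.

For the free product, each nontrivial word `w` imposes a Zariski closed condition `w(g) = 1`
(`isZariskiClosed_wordHom_eq_one`), and there are countably many words. One tuple satisfying none of
these conditions shows that all are proper (`wordHom_pingPongAut_ne_one`). It consists of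
transvections preserving the diagonal line `(t : … : t : 1)`. There `σ_n` acts by `t ↦ 1/t` and the
transvections act as parabolic maps, so ping-pong on discs applies. Density of the complement is
Baire's theorem (`dense_compl_of_isZariskiClosed`). The elements `g_i σ_n` are free because killing
the involution retracts the free product onto a free group. -/

lemma aeval_scale {m d : ℕ} {p : MvPolynomial (Fin m) ℂ} (hp : p.IsHomogeneous d)
    (c : K) (v : Fin m → K) : aeval (fun i => c * v i) p = c ^ d * aeval v p := by
  rw [aeval_def, aeval_def, eval₂_eq, eval₂_eq, Finset.mul_sum]
  refine Finset.sum_congr rfl fun s hs => ?_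
  have hd : ∑ i ∈ s.support, s i = d := (hp.degree_eq_sum_deg_support hs).symm
  rw [← hd]
  simp only [mul_pow, Finset.prod_mul_distrib, Finset.prod_pow_eq_pow_sum]
  ring

/-- The birational map `φ` is represented by a tuple that sends the vector `v` of homogeneous
coordinates to a nonzero multiple of `w`. -/
def Maps (φ : Bir n) (v w : Fin (n + 1) → K) : Prop :=
  ∃ F : BirTuple n, Bir.mk F = φ ∧ ∃ c : K, c ≠ 0 ∧ ∀ i, aeval v (F.1.poly i) = c * w i

lemma Maps.mul {φ ψ : Bir n} {u v w : Fin (n + 1) → K} (hφ : Maps φ v w) (hψ : Maps ψ u v) :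
    Maps (φ * ψ) u w := by
  obtain ⟨F, rfl, c, hc, hF⟩ := hφ
  obtain ⟨G, rfl, d, hd, hG⟩ := hψ
  refine ⟨F.comp G, rfl, d ^ F.1.deg * c, mul_ne_zero (pow_ne_zero _ hd) hc, fun i => ?_⟩
  change aeval u (aeval G.1.poly (F.1.poly i)) = _
  rw [comp_aeval_apply, funext hG, aeval_scale (F.1.homog i), hF i, mul_assoc]

/-- A vector is generic if it is not a zero of any nonzero homogeneous polynomial. -/
def Gen (v : Fin (n + 1) → K) : Prop :=
  ∀ (d : ℕ) (p : MvPolynomial (Fin (n + 1)) ℂ), p.IsHomogeneous d → p ≠ 0 → aeval v p ≠ 0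

/-- A polynomial vanishing at `w` pulls back along `φ` to one vanishing at `v`, and pullback along
an invertible tuple kills no nonzero homogeneous polynomial. Genericity therefore persists through
every stage of a composite. -/
lemma Gen.maps {φ : Bir n} {v w : Fin (n + 1) → K} (hv : Gen v) (h : Maps φ v w) : Gen w := by
  obtain ⟨F, -, c, hc, hF⟩ := h
  intro d p hp hp0 h0
  obtain ⟨F', h1, -⟩ := F.2
  refine hv _ _ (hp.aeval F.1.poly F.1.homog) (fun h => hp0 (eq_zero_of_aeval_eq_zero h1 hp h)) ?_
  rw [comp_aeval_apply, funext hF, aeval_scale hp, h0, mul_zero]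

/-- The cross products `F_i G_j - F_j G_i` are homogeneous and vanish at `v`, hence are zero. -/
lemma Gen.ext {φ ψ : Bir n} {v w : Fin (n + 1) → K} (hv : Gen v) (hφ : Maps φ v w)
    (hψ : Maps ψ v w) : φ = ψ := by
  obtain ⟨F, rfl, c, hc, hF⟩ := hφ
  obtain ⟨G, rfl, d, hd, hG⟩ := hψ
  refine Quotient.sound fun i j => ?_
  by_contra hne
  refine hv (F.1.deg + G.1.deg) _
    (((F.1.homog i).mul (G.1.homog j)).sub ((F.1.homog j).mul (G.1.homog i))) (sub_ne_zero.2 hne) ?_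
  simp only [map_sub, map_mul, hF, hG]
  ring

/-- Representatives of `φ` agree up to proportionality at the vector `v`. -/
lemma Maps.proportional {F G : BirTuple n} (h : Bir.mk F = Bir.mk G) (v : Fin (n + 1) → K)
    (i j : Fin (n + 1)) :
    aeval v (F.1.poly i) * aeval v (G.1.poly j) = aeval v (F.1.poly j) * aeval v (G.1.poly i) := by
  have := congrArg (aeval v) ((Quotient.exact h : F.1.Equiv G.1) i j)
  simpa only [map_mul] using this

lemma Maps.one_proportional {v w : Fin (n + 1) → K} (h : Maps (1 : Bir n) v w)
    (i j : Fin (n + 1)) : w i * v j = w j * v i := by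
  obtain ⟨F, hF, c, hc, hw⟩ := h
  have := Maps.proportional (G := ⟨Tuple.id n, Tuple.id n, id_isLeftInv, id_isLeftInv⟩) hF v i j
  rw [hw, hw] at this
  simp only [Tuple.id, aeval_X] at this
  exact mul_left_cancel₀ hc (by linear_combination this)

lemma maps_glToBir (A : GL (Fin (n + 1)) ℂ) {v w : Fin (n + 1) → K} {c : K} (hc : c ≠ 0)
    (h : ∀ i, ∑ j, algebraMap ℂ K (A.1 i j) * v j = c * w i) : Maps (glToBir n A) v w := by
  refine ⟨_, rfl, c, hc, fun i => ?_⟩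
  rw [← h i]
  simp [linTuple]

lemma maps_sigma [NeZero n] {v w : Fin (n + 1) → K} {c : K} (hc : c ≠ 0) (hv : ∀ i, v i ≠ 0)
    (h : ∀ i, (v i)⁻¹ = c * w i) : Maps (sigma n) v w := by
  refine ⟨_, rfl, (∏ j, v j) * c, mul_ne_zero (Finset.prod_ne_zero_iff.2 fun j _ => hv j) hc,
    fun i => ?_⟩
  rw [mul_assoc, ← h i, ← Finset.prod_erase_mul _ _ (Finset.mem_univ i), mul_assoc,
    mul_inv_cancel₀ (hv i), mul_one]
  simp [sigmaTuple]

end Points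

/-! ### The affine chart, homogenization and the generic point -/

/-- The inclusion of the affine chart, in homogeneous coordinates. -/
def chart {R : Type*} [One R] (z : Fin n → R) : Fin (n + 1) → R := Fin.snoc z 1

@[simp] lemma chart_castSucc {R : Type*} [One R] (z : Fin n → R) (i : Fin n) :
    chart z i.castSucc = z i := by simp [chart]

@[simp] lemma chart_last {R : Type*} [One R] (z : Fin n → R) :
    chart z (Fin.last n) = 1 := by simp [chart]

lemma chart_update {R : Type*} [One R] (z : Fin n → R) (i : Fin n) (a : R) :
    chart (Function.update z i a) = Function.update (chart z) i.castSucc a := by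
  simp [chart, Fin.snoc_update]

lemma map_chart {R S : Type*} [CommSemiring R] [CommSemiring S] (f : R →+* S) (z : Fin n → R)
    (i : Fin (n + 1)) : f (chart z i) = chart (fun j => f (z j)) i := by
  induction i using Fin.lastCases <;> simp

/-- Dehomogenization with respect to the last coordinate. -/
def dehom (n : ℕ) : MvPolynomial (Fin (n + 1)) ℂ →ₐ[ℂ] MvPolynomial (Fin n) ℂ := aeval (chart X)

lemma aeval_dehom {A : Type*} [CommRing A] [Algebra ℂ A] (z : Fin n → A)
    (p : MvPolynomial (Fin (n + 1)) ℂ) : aeval z (dehom n p) = aeval (chart z) p := by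
  rw [dehom, comp_aeval_apply]
  congr 2
  funext i
  rw [← RingHom.coe_coe, map_chart]
  simp

lemma eq_zero_of_dehom_eq_zero {d : ℕ} {p : MvPolynomial (Fin (n + 1)) ℂ}
    (hp : p.IsHomogeneous d) (h : dehom n p = 0) : p = 0 := by
  -- The factor `X (Fin.last n)` takes care of the hyperplane at infinity, where `h` gives no direct
  -- information.
  have h1 : X (Fin.last n) * p = 0 := by
    refine MvPolynomial.funext fun y => ?_
    rw [map_mul, eval_X, map_zero]
    by_cases hy : y (Fin.last n) = 0
    · rw [hy, zero_mul]
    · have e : y = fun i => y (Fin.last n) * chart (fun j => y j.castSucc / y (Fin.last n)) i := by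
        funext i
        induction i using Fin.lastCases with
        | last => simp
        | cast i => rw [chart_castSucc]; field_simp
      rw [← aeval_eq_eval, e, aeval_scale hp, ← aeval_dehom, h, map_zero, mul_zero,
        mul_zero]
  exact (mul_eq_zero.1 h1).resolve_left (X_ne_zero _)

lemma exists_homogenization (p : MvPolynomial (Fin n) ℂ) {d : ℕ} (hd : p.totalDegree ≤ d) :
    ∃ P : MvPolynomial (Fin (n + 1)) ℂ, P.IsHomogeneous d ∧ dehom n P = p := by
  refine ⟨∑ i ∈ Finset.range (p.totalDegree + 1),
    rename Fin.castSucc (homogeneousComponent i p) * X (Fin.last n) ^ (d - i),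
    IsHomogeneous.sum _ _ _ fun i hi => ?_, ?_⟩
  · have hi' : i ≤ d := (Nat.lt_succ_iff.1 (Finset.mem_range.1 hi)).trans hd
    have := (IsHomogeneous.rename_isHomogeneous (f := Fin.castSucc)
      (homogeneousComponent_isHomogeneous i p)).mul
      (isHomogeneous_X_pow (R := ℂ) (Fin.last n) (d - i))
    rwa [Nat.add_sub_cancel' hi'] at this
  · rw [map_sum]
    conv_rhs => rw [← sum_homogeneousComponent p]
    refine Finset.sum_congr rfl fun i _ => ?_
    rw [map_mul, map_pow, dehom, aeval_rename, aeval_X, chart_last, one_pow, mul_one]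
    have : (chart X ∘ Fin.castSucc : Fin n → MvPolynomial (Fin n) ℂ) = X := by
      funext j; simp
    rw [this, aeval_X_left_apply]

/-- `φ` is given on the affine chart by the polynomials `p`, without denominators. -/
def Lifts (φ : Bir n) (p : Fin n → MvPolynomial (Fin n) ℂ) : Prop :=
  ∃ F : BirTuple n, Bir.mk F = φ ∧ ∀ i, dehom n (F.1.poly i) = chart p i

lemma Lifts.maps {K : Type*} [Field K] [Algebra ℂ K] {φ : Bir n}
    {p : Fin n → MvPolynomial (Fin n) ℂ} (h : Lifts φ p) (z : Fin n → K) :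
    Maps φ (chart z) (chart fun i => aeval z (p i)) := by
  obtain ⟨F, rfl, hF⟩ := h
  refine ⟨F, rfl, 1, one_ne_zero, fun i => ?_⟩
  rw [← aeval_dehom, hF, one_mul, ← RingHom.coe_coe, map_chart]

lemma Lifts.extends {φ : Bir n} {p : Fin n → MvPolynomial (Fin n) ℂ} (h : Lifts φ p)
    {f : (Fin n → ℂ) → (Fin n → ℂ)} (hf : ∀ z i, f z i = eval z (p i)) : φ.Extends f := by
  obtain ⟨F, rfl, hF⟩ := h
  refine ⟨F, rfl, fun z => ⟨1, one_ne_zero, fun i => ?_⟩⟩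
  change eval (chart z) _ = 1 * chart (f z) i
  rw [← coe_aeval_eq_eval, RingHom.coe_coe, ← aeval_dehom, hF, one_mul, ← RingHom.coe_coe,
    map_chart]
  congr 1
  funext j
  rw [hf, coe_aeval_eq_eval]

/-- Homogenizing `p` and `q` to tuples gives rational inverses of each other, since homogeneous
polynomials of equal degree are compared after setting the last coordinate to one. -/
lemma exists_lifts {p q : Fin n → MvPolynomial (Fin n) ℂ} (hpq : ∀ i, aeval q (p i) = X i)
    (hqp : ∀ i, aeval p (q i) = X i) : ∃ φ : Bir n, Lifts φ p := by
  have key : ∀ p : Fin n → MvPolynomial (Fin n) ℂ, ∃ F : Tuple n,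
      ∀ i, dehom n (F.poly i) = chart p i := by
    intro p
    -- One common degree bounds all coordinates; the summand `1` keeps it positive.
    have : ∀ i, (chart p i).totalDegree ≤ 1 + ∑ i, (p i).totalDegree := by
      intro i
      induction i using Fin.lastCases with
      | last => simp
      | cast i =>
        rw [chart_castSucc]
        exact (Finset.single_le_sum (f := fun i => (p i).totalDegree) (fun _ _ => Nat.zero_le _)
          (Finset.mem_univ i)).trans (Nat.le_add_left _ _)
    choose P hP hP' using fun i => exists_homogenization (chart p i) (this i)
    exact ⟨⟨P, _, by omega, hP⟩, hP'⟩
  obtain ⟨F, hF⟩ := key p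
  obtain ⟨G, hG⟩ := key q
  have inv : ∀ (p q : Fin n → MvPolynomial (Fin n) ℂ) (F G : Tuple n),
      (∀ i, aeval q (p i) = X i) → (∀ i, dehom n (F.poly i) = chart p i) →
      (∀ i, dehom n (G.poly i) = chart q i) → F.IsLeftInv G := by
    intro p q F G hpq hF hG
    have hdeg : 1 ≤ G.deg * F.deg := Nat.mul_pos G.deg_pos F.deg_pos
    refine ⟨X (Fin.last n) ^ (G.deg * F.deg - 1), pow_ne_zero _ (X_ne_zero _), fun i => ?_⟩
    have h1 := (isHomogeneous_X_pow (R := ℂ) (Fin.last n) (G.deg * F.deg - 1)).mul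
      (isHomogeneous_X ℂ i)
    rw [Nat.sub_add_cancel hdeg] at h1
    refine sub_eq_zero.1 (eq_zero_of_dehom_eq_zero (((F.homog i).aeval G.poly G.homog).sub h1) ?_)
    rw [map_sub, sub_eq_zero, comp_aeval_apply, funext hG, ← aeval_dehom, hF, map_mul, map_pow,
      dehom, aeval_X, aeval_X, chart_last, one_pow, one_mul, ← RingHom.coe_coe, map_chart]
    congr 1
    exact funext hpq
  exact ⟨Bir.mk ⟨F, G, inv p q F G hpq hF hG, inv q p G F hqp hG hF⟩, _, rfl, hF⟩

/-- The function field of affine space. -/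
abbrev FunField (n : ℕ) : Type := FractionRing (MvPolynomial (Fin n) ℂ)

/-- The coordinate functions in the function field. -/
def coord (n : ℕ) (i : Fin n) : FunField n := algebraMap (MvPolynomial (Fin n) ℂ) _ (X i)

lemma gen_coord (n : ℕ) : Gen (chart (coord n)) := by
  intro d p hp hp0 h
  refine hp0 (eq_zero_of_dehom_eq_zero hp ?_)
  rw [← aeval_dehom] at h
  have : aeval (coord n) (dehom n p) = algebraMap _ (FunField n) (dehom n p) := by
    have e : coord n = fun i => IsScalarTower.toAlgHom ℂ (MvPolynomial (Fin n) ℂ) (FunField n) (X i)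
        := rfl
    rw [e, ← comp_aeval_apply, aeval_X_left_apply]
    rfl
  rw [this] at h
  exact (FaithfulSMul.algebraMap_injective (MvPolynomial (Fin n) ℂ) (FunField n))
    (h.trans (map_zero _).symm)

/-! ### Monomial maps obtained from the standard involution and transvections -/

section Generators

variable {K : Type*} [Field K] [Algebra ℂ K]

lemma Gen.ne_zero {v : Fin (n + 1) → K} (hv : Gen v) (i : Fin (n + 1)) : v i ≠ 0 := by
  simpa using hv 1 (X i) (isHomogeneous_X ℂ i) (X_ne_zero i)

lemma glToBir_mem_G [NeZero n] (A : GL (Fin (n + 1)) ℂ) : glToBir n A ∈ G n :=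
  Subgroup.subset_closure (Or.inr ⟨Matrix.ProjGenLinGroup.mk A, rfl⟩)

lemma sigma_mem_G [NeZero n] : sigma n ∈ G n := Subgroup.subset_closure (Or.inl rfl)

/-- The automorphism of projective space that adds `c * y_b` to the coordinate `y_a`. -/
def transv {a b : Fin (n + 1)} (hab : a ≠ b) (c : ℂ) : GL (Fin (n + 1)) ℂ where
  val := Matrix.transvection a b c
  inv := Matrix.transvection a b (-c)
  val_inv := by rw [Matrix.transvection_mul_transvection_same a b hab, add_neg_cancel,
    Matrix.transvection_zero]
  inv_val := by rw [Matrix.transvection_mul_transvection_same a b hab, neg_add_cancel,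
    Matrix.transvection_zero]

lemma maps_transv {a b : Fin (n + 1)} (hab : a ≠ b) (c : ℂ) (y : Fin (n + 1) → K) :
    Maps (glToBir n (transv hab c)) y (Function.update y a (y a + algebraMap ℂ K c * y b)) := by
  refine maps_glToBir _ one_ne_zero fun i => ?_
  simp only [transv, Matrix.transvection, Matrix.add_apply, map_add, add_mul,
    Finset.sum_add_distrib, one_mul, Matrix.one_apply, Matrix.single_apply]
  by_cases h : i = a
  · subst h
    simp [Function.update_self, apply_ite (algebraMap ℂ K), ite_mul]
  · simp [Function.update_of_ne h, apply_ite (algebraMap ℂ K), ite_mul, Ne.symm h]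

lemma maps_sigma_inv [NeZero n] {v : Fin (n + 1) → K} (hv : ∀ i, v i ≠ 0) :
    Maps (sigma n) v (fun i => (v i)⁻¹) :=
  maps_sigma one_ne_zero hv fun _ => (one_mul _).symm

/-- In terms of `t = y_a / y_b` this is the identity `1 + 1 / (1 / (t + 1) - 1) = -1 / t`. The two
uses of `σ_n` cancel on every coordinate other than `y_a`. -/
lemma exists_inversion [NeZero n] {a b : Fin (n + 1)} (hab : a ≠ b) :
    ∃ φ ∈ G n, ∀ y : Fin (n + 1) → K, Gen y → Maps φ y (Function.update y a (-(y b) ^ 2 / y a)) := by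
  refine ⟨glToBir n (transv hab 1) * (sigma n * (glToBir n (transv hab (-1)) *
    (sigma n * glToBir n (transv hab 1)))), ?_, fun y hy => ?_⟩
  · exact mul_mem (glToBir_mem_G _) (mul_mem sigma_mem_G (mul_mem (glToBir_mem_G _)
      (mul_mem sigma_mem_G (glToBir_mem_G _))))
  have m1 := maps_transv hab 1 y
  have g1 := hy.maps m1
  have m2 := maps_sigma_inv g1.ne_zero
  have g2 := g1.maps m2
  have m3 := maps_transv hab (-1) (fun i => ((Function.update y a (y a + algebraMap ℂ K 1 * y b)) i)⁻¹)
  have g3 := g2.maps m3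
  have m4 := maps_sigma_inv g3.ne_zero
  have m5 := m4.mul (m3.mul (m2.mul m1))
  have m6 := (maps_transv hab 1 _).mul m5
  convert m6 using 1
  have ha := hy.ne_zero a
  have hb := hy.ne_zero b
  have hs : y a + y b ≠ 0 := by simpa using g1.ne_zero a
  funext i
  by_cases h : i = a
  · subst h
    simp only [Function.update_self, Function.update_of_ne hab.symm, map_one, map_neg, one_mul]
    have e : (y i + y b)⁻¹ + -1 * (y b)⁻¹ = -(y i) / ((y i + y b) * y b) := by
      field_simp
      ring
    rw [e]
    field_simp
    ring
  · simp [Function.update_of_ne h]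

/-- Inverting `y_a` relative to `y_c` and then relative to `y_b` cancels both the signs and the
inversion. -/
lemma exists_mul_sq [NeZero n] {a b c : Fin (n + 1)} (hab : a ≠ b) (hac : a ≠ c) :
    ∃ φ ∈ G n, ∀ y : Fin (n + 1) → K, Gen y →
      Maps φ y (Function.update y a (y a * (y b / y c) ^ 2)) := by
  obtain ⟨φ, hφ, h1⟩ := exists_inversion (K := K) hab
  obtain ⟨ψ, hψ, h2⟩ := exists_inversion (K := K) hac
  refine ⟨φ * ψ, mul_mem hφ hψ, fun y hy => ?_⟩
  have m := (h1 _ (hy.maps (h2 y hy))).mul (h2 y hy)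
  have ha := hy.ne_zero a
  have hc := hy.ne_zero c
  convert m using 1
  rw [Function.update_idem]
  congr 1
  rw [Function.update_self, Function.update_of_ne hab.symm]
  field_simp

/-- The map `z_i ↦ z_i * z_j ^ 2` lies in `G`. -/
lemma exists_affine_mul_sq [NeZero n] {i j : Fin n} (hij : i ≠ j) :
    ∃ φ ∈ G n, ∀ z : Fin n → K, Gen (chart z) →
      Maps φ (chart z) (chart (Function.update z i (z i * z j ^ 2))) := by
  obtain ⟨φ, hφ, h⟩ := exists_mul_sq (K := K) (a := i.castSucc) (b := j.castSucc) (c := Fin.last n)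
    (fun h => hij (Fin.castSucc_injective _ h)) (Fin.castSucc_lt_last i).ne
  refine ⟨φ, hφ, fun z hz => ?_⟩
  simpa [chart_update] using h _ hz

lemma maps_translation (j : Fin n) (c : ℂ) (z : Fin n → K) :
    Maps (glToBir n (transv (Fin.castSucc_lt_last j).ne c)) (chart z)
      (chart (Function.update z j (z j + algebraMap ℂ K c))) := by
  simpa [chart_update] using maps_transv (Fin.castSucc_lt_last j).ne c (chart z)

/-- The map `z_i ↦ z_i * (z_j + 1) ^ 2` lies in `G`. -/
lemma exists_affine_mul_add_one_sq [NeZero n] {i j : Fin n} (hij : i ≠ j) :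
    ∃ φ ∈ G n, ∀ z : Fin n → K, Gen (chart z) →
      Maps φ (chart z) (chart (Function.update z i (z i * (z j + 1) ^ 2))) := by
  obtain ⟨φ, hφ, h⟩ := exists_affine_mul_sq (K := K) hij
  -- Conjugate `z_i ↦ z_i * z_j ^ 2` by the translation `z_j ↦ z_j + 1`.
  refine ⟨glToBir n (transv (Fin.castSucc_lt_last j).ne (-1)) *
    (φ * glToBir n (transv (Fin.castSucc_lt_last j).ne 1)),
    mul_mem (glToBir_mem_G _) (mul_mem hφ (glToBir_mem_G _)), fun z hz => ?_⟩
  have m1 := maps_translation j 1 z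
  have m2 := (h _ (hz.maps m1)).mul m1
  convert (maps_translation j (-1) _).mul m2 using 2
  funext l
  by_cases h1 : l = i
  · subst h1
    simp [Function.update_of_ne hij]
  · by_cases h2 : l = j
    · subst h2
      simp [Function.update_of_ne h1]
    · simp [Function.update_of_ne h1, Function.update_of_ne h2]

end Generators

/-! ### Shears belong to `G n` -/

/-- The coordinates of the shear `z_i ↦ z_i + P`, where `P` does not depend on `z_i`. -/
def shearPoly (i : Fin n) (P : MvPolynomial {j // j ≠ i} ℂ) : Fin n → MvPolynomial (Fin n) ℂ :=
  Function.update X i (X i + rename Subtype.val P)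

lemma aeval_shearPoly {A : Type*} [CommRing A] [Algebra ℂ A] (i : Fin n)
    (P : MvPolynomial {j // j ≠ i} ℂ) (z : Fin n → A) :
    (fun j => aeval z (shearPoly i P j)) =
      Function.update z i (z i + aeval (fun j : {j // j ≠ i} => z j) P) := by
  funext j
  by_cases h : j = i
  · subst h
    simp [shearPoly, aeval_rename, Function.comp_def]
  · simp [shearPoly, Function.update_of_ne h]

lemma aeval_update_of_ne {A : Type*} [CommRing A] [Algebra ℂ A] (i : Fin n)
    (P : MvPolynomial {j // j ≠ i} ℂ) (z : Fin n → A) (a : A) :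
    aeval (fun j : {j // j ≠ i} => Function.update z i a j) P =
      aeval (fun j : {j // j ≠ i} => z j) P := by
  congr 2
  funext j
  exact Function.update_of_ne j.2 _ _

lemma aeval_shearPoly_neg (i : Fin n) (P : MvPolynomial {j // j ≠ i} ℂ) (j : Fin n) :
    aeval (shearPoly i (-P)) (shearPoly i P j) = X j := by
  have h := congrFun (aeval_shearPoly i P (shearPoly i (-P))) j
  have h' : shearPoly i (-P) = Function.update X i (X i - rename Subtype.val P) := by
    rw [shearPoly, map_neg, sub_eq_add_neg]
  rw [h, h', aeval_update_of_ne, Function.update_idem, Function.update_self]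
  have e : rename Subtype.val P =
      aeval (fun j : {j // j ≠ i} => (X j.1 : MvPolynomial (Fin n) ℂ)) P := by
    have := aeval_rename (Subtype.val : {j // j ≠ i} → Fin n) (X : Fin n → MvPolynomial (Fin n) ℂ) P
    rwa [aeval_X_left_apply] at this
  rw [e, sub_add_cancel, Function.update_eq_self]

lemma exists_shear (i : Fin n) (P : MvPolynomial {j // j ≠ i} ℂ) :
    ∃ φ : Bir n, Lifts φ (shearPoly i P) :=
  exists_lifts (aeval_shearPoly_neg i P) fun j => by
    simpa using aeval_shearPoly_neg i (-P) j

/-- The shear `z_i ↦ z_i + P` as a birational map. -/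
def shear (i : Fin n) (P : MvPolynomial {j // j ≠ i} ℂ) : Bir n := (exists_shear i P).choose

lemma shear_lifts (i : Fin n) (P : MvPolynomial {j // j ≠ i} ℂ) : Lifts (shear i P) (shearPoly i P) :=
  (exists_shear i P).choose_spec

lemma maps_shear {K : Type*} [Field K] [Algebra ℂ K] (i : Fin n) (P : MvPolynomial {j // j ≠ i} ℂ)
    (z : Fin n → K) : Maps (shear i P) (chart z)
      (chart (Function.update z i (z i + aeval (fun j : {j // j ≠ i} => z j) P))) := by
  rw [← aeval_shearPoly]
  exact (shear_lifts i P).maps z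

lemma Gen.shear_add {K : Type*} [Field K] [Algebra ℂ K] {z : Fin n → K} (hz : Gen (chart z))
    (i : Fin n) (P Q : MvPolynomial {j // j ≠ i} ℂ) : shear i (P + Q) = shear i P * shear i Q := by
  refine hz.ext (maps_shear i _ _) ?_
  convert (maps_shear i P _).mul (maps_shear i Q z) using 2
  rw [aeval_update_of_ne, Function.update_idem, Function.update_self, map_add, add_assoc,
    add_comm (aeval _ Q)]

lemma shear_add (i : Fin n) (P Q : MvPolynomial {j // j ≠ i} ℂ) :
    shear i (P + Q) = shear i P * shear i Q :=
  (gen_coord n).shear_add i P Q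

lemma shear_zero (i : Fin n) : shear i 0 = 1 := by
  have := shear_add i 0 0
  rwa [add_zero, eq_comm, mul_eq_left] at this

lemma shear_neg (i : Fin n) (P : MvPolynomial {j // j ≠ i} ℂ) : shear i (-P) = (shear i P)⁻¹ := by
  rw [eq_inv_iff_mul_eq_one, ← shear_add, neg_add_cancel, shear_zero]

/-- If multiplication of `z_i` by `Q` is a birational map in `G`, then the polynomials `P` such that
the shear `z_i ↦ z_i + P` lies in `G` are stable under multiplication by `Q`. -/
lemma Gen.shear_mul_mem [NeZero n] {K : Type*} [Field K] [Algebra ℂ K] {z : Fin n → K}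
    (hz : Gen (chart z)) {i : Fin n} {P Q : MvPolynomial {j // j ≠ i} ℂ} (hP : shear i P ∈ G n)
    (hQ : ∃ φ ∈ G n, ∀ z : Fin n → K, Gen (chart z) →
      Maps φ (chart z) (chart (Function.update z i (z i * aeval (fun j : {j // j ≠ i} => z j) Q)))) :
    shear i (P * Q) ∈ G n := by
  obtain ⟨φ, hφ, h⟩ := hQ
  -- `(z_i + P) Q = z_i Q + P Q`, and `Q` is unaffected by the shear.
  have key : shear i (P * Q) * φ = φ * shear i P := by
    refine hz.ext ((maps_shear i _ _).mul (h _ hz)) ?_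
    have m := maps_shear i P z
    convert (h _ (hz.maps m)).mul m using 2
    simp only [aeval_update_of_ne, Function.update_idem, Function.update_self, map_mul, add_mul]
  rw [eq_mul_inv_of_mul_eq key]
  exact mul_mem (mul_mem hφ hP) (inv_mem hφ)

lemma shear_C_mem [NeZero n] (i : Fin n) (c : ℂ) : shear i (C c) ∈ G n := by
  have : shear i (C c) = glToBir n (transv (Fin.castSucc_lt_last i).ne c) := by
    refine (gen_coord n).ext (maps_shear i _ _) ?_
    simpa using maps_translation i c (coord n)
  rw [this]
  exact glToBir_mem_G _

lemma shear_mem_G [NeZero n] (i : Fin n) (P : MvPolynomial {j // j ≠ i} ℂ) : shear i P ∈ G n := by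
  -- The scalar must be free in the induction, because the step for `X j` invokes the hypothesis at
  -- `c / 2`.
  suffices h : ∀ c : ℂ, shear i (P * C c) ∈ G n by simpa using h 1
  induction P using MvPolynomial.induction_on with
  | C a =>
    intro c
    rw [← C_mul]
    exact shear_C_mem i _
  | add P Q hP hQ =>
    intro c
    rw [add_mul, shear_add]
    exact mul_mem (hP c) (hQ c)
  | mul_X P j hP =>
    intro c
    have h0 := hP (c / 2)
    have h1 := (gen_coord n).shear_mul_mem (Q := X j ^ 2) h0 (by
      simpa using exists_affine_mul_sq (K := FunField n) (i := i) (j := j) j.2.symm)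
    have h2 := (gen_coord n).shear_mul_mem (Q := (X j + 1) ^ 2) h0 (by
      simpa using exists_affine_mul_add_one_sq (K := FunField n) (i := i) (j := j) j.2.symm)
    -- Polarization: `2 X_j = (X_j + 1)² - X_j² - 1`.
    have e : P * X j * C c = P * C (c / 2) * (X j + 1) ^ 2 +
        (-(P * C (c / 2) * X j ^ 2) + -(P * C (c / 2))) := by
      have : (C c : MvPolynomial {j // j ≠ i} ℂ) = C (c / 2) + C (c / 2) := by
        rw [← C_add, add_halves]
      rw [this]
      ring
    rw [e, shear_add, shear_add, shear_neg, shear_neg]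
    exact mul_mem h2 (mul_mem (inv_mem h1) (inv_mem h0))

/-! ### Extension of permutations of affine space; the affine case -/

lemma Bir.Extends.mul {φ ψ : Bir n} {f g : (Fin n → ℂ) → (Fin n → ℂ)} (hφ : φ.Extends f)
    (hψ : ψ.Extends g) : (φ * ψ).Extends (f ∘ g) := by
  obtain ⟨F, rfl, hF⟩ := hφ
  obtain ⟨G, rfl, hG⟩ := hψ
  refine ⟨F.comp G, rfl, fun z => ?_⟩
  obtain ⟨c, hc, h⟩ := hG z
  obtain ⟨d, hd, h'⟩ := hF (g z)
  refine ⟨c ^ F.1.deg * d, mul_ne_zero (pow_ne_zero _ hc) hd, fun i => ?_⟩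
  change eval _ (aeval G.1.poly (F.1.poly i)) = _
  rw [mul_assoc, Function.comp_apply, ← h' i, ← coe_aeval_eq_eval, ← coe_aeval_eq_eval,
    RingHom.coe_coe, RingHom.coe_coe, comp_aeval_apply, ← aeval_scale (F.1.homog i)]
  congr 2
  funext j
  rw [← h j, ← coe_aeval_eq_eval, RingHom.coe_coe]

lemma Bir.Extends.one : (1 : Bir n).Extends id :=
  ⟨⟨Tuple.id n, Tuple.id n, id_isLeftInv, id_isLeftInv⟩, rfl, fun z => ⟨1, one_ne_zero, fun i => by
    simp [Tuple.id]⟩⟩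

/-- The cross products of two representatives vanish at every point of the chart, hence identically.
This is what makes the choice of extensions multiplicative. -/
lemma Bir.Extends.unique {φ ψ : Bir n} {f : (Fin n → ℂ) → (Fin n → ℂ)} (hφ : φ.Extends f)
    (hψ : ψ.Extends f) : φ = ψ := by
  obtain ⟨F, rfl, hF⟩ := hφ
  obtain ⟨G, rfl, hG⟩ := hψ
  refine Quotient.sound fun i j => sub_eq_zero.1 (eq_zero_of_dehom_eq_zero
    (((F.1.homog i).mul (G.1.homog j)).sub ((F.1.homog j).mul (G.1.homog i))) ?_)
  refine MvPolynomial.funext fun z => ?_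
  obtain ⟨c, -, h⟩ := hF z
  obtain ⟨d, -, h'⟩ := hG z
  rw [map_zero, ← coe_aeval_eq_eval, RingHom.coe_coe, aeval_dehom, ← RingHom.coe_coe,
    coe_aeval_eq_eval]
  change eval (Fin.snoc z 1 : Fin (n + 1) → ℂ) _ = 0
  rw [map_sub, map_mul, map_mul, h, h, h', h']
  ring

lemma Bir.Extends.eq_id {f : (Fin n → ℂ) → (Fin n → ℂ)} (h : (1 : Bir n).Extends f) (z : Fin n → ℂ) :
    f z = z := by
  obtain ⟨F, hF, h⟩ := h
  obtain ⟨c, hc, h⟩ := h z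
  have hm : Maps (1 : Bir n) (chart z) (chart (f z)) :=
    ⟨F, hF, c, hc, fun i => by rw [← RingHom.coe_coe, coe_aeval_eq_eval]; exact h i⟩
  funext i
  simpa using hm.one_proportional i.castSucc (Fin.last n)

/-- The permutations of affine space that extend, together with their inverses, to elements
of `G`. -/
def extGroup (n : ℕ) [NeZero n] : Subgroup (Equiv.Perm (Fin n → ℂ)) where
  carrier := {f | ∃ φ ∈ G n, φ.Extends f ∧ (φ⁻¹).Extends f.symm}
  mul_mem' := by
    rintro f g ⟨φ, hφ, h1, h2⟩ ⟨ψ, hψ, h3, h4⟩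
    refine ⟨φ * ψ, mul_mem hφ hψ, h1.mul h3, ?_⟩
    rw [mul_inv_rev]
    exact h4.mul h2
  one_mem' := ⟨1, one_mem _, Bir.Extends.one, by rw [inv_one]; exact Bir.Extends.one⟩
  inv_mem' := by
    rintro f ⟨φ, hφ, h1, h2⟩
    exact ⟨φ⁻¹, inv_mem hφ, h2, by rw [inv_inv]; exact h1⟩

lemma glToBir_extends {A : GL (Fin (n + 1)) ℂ} {f : (Fin n → ℂ) → (Fin n → ℂ)}
    (h : ∀ z, A.1.mulVec (chart z) = chart (f z)) : (glToBir n A).Extends f := by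
  refine ⟨_, rfl, fun z => ⟨1, one_ne_zero, fun i => ?_⟩⟩
  rw [one_mul]
  refine Eq.trans ?_ (congrFun (h z) i)
  simp [linTuple, Matrix.mulVec, dotProduct, chart]

lemma exists_eval_eq_of_totalDegree_le_one {p : MvPolynomial (Fin n) ℂ} (hp : p.totalDegree ≤ 1) :
    ∃ (b : ℂ) (a : Fin n → ℂ), ∀ x, eval x p = ∑ j, a j * x j + b := by
  have h1 : p = homogeneousComponent 1 p + C (coeff 0 p) := by
    conv_lhs => rw [← sum_homogeneousComponent p]
    rw [Finset.sum_subset (Finset.range_mono (Nat.succ_le_succ hp)) fun i _ hi =>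
      homogeneousComponent_eq_zero _ _ (by simpa using hi), Finset.sum_range_succ,
      Finset.sum_range_one, homogeneousComponent_zero, add_comm]
  have h2 : homogeneousComponent 1 p ∈ homogeneousSubmodule (Fin n) ℂ 1 :=
    homogeneousComponent_isHomogeneous 1 p
  rw [homogeneousSubmodule_one_eq_span_X, Submodule.mem_span_range_iff_exists_fun] at h2
  obtain ⟨a, ha⟩ := h2
  refine ⟨coeff 0 p, a, fun x => ?_⟩
  have h3 := congrArg (eval x) h1
  rw [map_add, eval_C, ← ha] at h3
  rw [h3]
  simp [smul_eval]

lemma affine_mem_extGroup [NeZero n] {f : Equiv.Perm (Fin n → ℂ)} (hf : IsAffine f) :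
    f ∈ extGroup n := by
  obtain ⟨p, hp, hdeg⟩ := hf
  choose b a hab using fun i => exists_eval_eq_of_totalDegree_le_one (hdeg i)
  -- The block matrix with rows `(a i, b i)` and last row `(0, …, 0, 1)`.
  let M : Matrix (Fin (n + 1)) (Fin (n + 1)) ℂ := Matrix.of
    (Fin.snoc (fun i => (Fin.snoc (a i) (b i) : Fin (n + 1) → ℂ)) (chart 0) :
      Fin (n + 1) → Fin (n + 1) → ℂ)
  have hMc : ∀ (v : Fin (n + 1) → ℂ) (i : Fin n), M.mulVec v i.castSucc =
      ∑ j, a i j * v j.castSucc + b i * v (Fin.last n) := fun v i => by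
    simp [M, Matrix.mulVec, dotProduct, Fin.sum_univ_castSucc]
  have hMl : ∀ v : Fin (n + 1) → ℂ, M.mulVec v (Fin.last n) = v (Fin.last n) := fun v => by
    simp [M, Matrix.mulVec, dotProduct, Fin.sum_univ_castSucc]
  have hM : ∀ z, M.mulVec (chart z) = chart (f z) := by
    intro z
    funext i
    induction i using Fin.lastCases with
    | last => simp [hMl]
    | cast i => simp [hMc, hp z i, hab]
  have hdet : M.det ≠ 0 := by
    rw [Ne, ← Matrix.exists_mulVec_eq_zero_iff]
    -- A kernel vector lies at infinity and is killed by the linear part of `f`, so `f` takes the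
    -- same value at its affine coordinates and at `0`.
    rintro ⟨v, hv, h0⟩
    have hl : v (Fin.last n) = 0 := by rw [← hMl v, h0]; rfl
    have hz : (fun i : Fin n => v i.castSucc) = 0 := by
      apply f.injective
      funext i
      have := congrFun h0 i.castSucc
      rw [hMc, hl, mul_zero, add_zero] at this
      rw [hp, hp, hab, hab, this]
      simp
    apply hv
    funext i
    induction i using Fin.lastCases with
    | last => exact hl
    | cast i => exact congrFun hz i
  let A : GL (Fin (n + 1)) ℂ := Matrix.GeneralLinearGroup.mkOfDetNeZero M hdet
  refine ⟨glToBir n A, glToBir_mem_G A, glToBir_extends hM, ?_⟩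
  rw [← map_inv]
  refine glToBir_extends fun z => ?_
  have h := hM (f.symm z)
  rw [Equiv.apply_symm_apply] at h
  have hA : (A⁻¹).1 * M = 1 := A.inv_mul
  rw [← h, Matrix.mulVec_mulVec, hA, Matrix.one_mulVec]

/-- The shear `z_i ↦ z_i + P` as a permutation of affine space. -/
def shearPerm (i : Fin n) (P : MvPolynomial {j // j ≠ i} ℂ) : Equiv.Perm (Fin n → ℂ) where
  toFun z := Function.update z i (z i + aeval (fun j : {j // j ≠ i} => z j) P)
  invFun z := Function.update z i (z i + aeval (fun j : {j // j ≠ i} => z j) (-P))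
  left_inv z := by simp [aeval_update_of_ne]
  right_inv z := by simp [aeval_update_of_ne]

lemma shear_extends (i : Fin n) (P : MvPolynomial {j // j ≠ i} ℂ) :
    (shear i P).Extends (shearPerm i P) :=
  (shear_lifts i P).extends fun z j => by
    rw [← coe_aeval_eq_eval]
    exact (congrFun (aeval_shearPoly i P z) j).symm

lemma shearPerm_mem_extGroup [NeZero n] (i : Fin n) (P : MvPolynomial {j // j ≠ i} ℂ) :
    shearPerm i P ∈ extGroup n := by
  refine ⟨shear i P, shear_mem_G i P, shear_extends i P, ?_⟩
  rw [← shear_neg]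
  exact shear_extends i (-P)

/-! ### Jonquières automorphisms and the embedding of the tame group -/

/-- By injectivity `q - q(0)` has no root but `0`, so `q = c t ^ d + q(0)`. Such a polynomial takes
equal values at `1` and at a primitive `d`-th root of unity, which forces `d = 1`. -/
lemma natDegree_eq_one_of_injective {q : Polynomial ℂ} (hq : Function.Injective fun t => q.eval t) :
    q.natDegree = 1 := by
  set r := q - Polynomial.C (q.eval 0) with hr
  have hd : r.natDegree = q.natDegree := Polynomial.natDegree_sub_C
  have hroots : ∀ t ∈ r.roots, t = 0 := fun t ht => hq <| by
    have := (Polynomial.mem_roots'.1 ht).2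
    simpa [hr, sub_eq_zero] using this
  have hsplit := IsAlgClosed.splits r
  have hr' : r = Polynomial.C r.leadingCoeff * Polynomial.X ^ q.natDegree := by
    conv_lhs => rw [hsplit.eq_prod_roots, Multiset.eq_replicate_of_mem hroots,
      ← hsplit.natDegree_eq_card_roots, hd]
    simp
  have hev : ∀ t, q.eval t = r.leadingCoeff * t ^ q.natDegree + q.eval 0 := fun t => by
    have := congrArg (Polynomial.eval t) hr'
    rw [hr] at this
    simp only [Polynomial.eval_sub, Polynomial.eval_C, Polynomial.eval_mul, Polynomial.eval_pow,
      Polynomial.eval_X] at this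
    rw [← hr] at this
    linear_combination this
  have hd0 : q.natDegree ≠ 0 := fun h0 => by
    obtain ⟨c, hc⟩ := Polynomial.natDegree_eq_zero.1 h0
    exact zero_ne_one (hq (a₁ := 0) (a₂ := 1) (by simp [← hc]))
  have hζ := Complex.isPrimitiveRoot_exp _ hd0
  have h1 := hq (a₁ := Complex.exp (2 * Real.pi * Complex.I / q.natDegree)) (a₂ := 1) (by
    change q.eval _ = q.eval _
    rw [hev, hev 1, hζ.pow_eq_one, one_pow])
  exact Nat.dvd_one.1 (hζ.dvd_of_pow_eq_one 1 (by rw [h1, pow_one]))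

/-- By the Nullstellensatz a polynomial without zeros generates the unit ideal, and the units are
the nonzero constants. -/
lemma exists_eq_C_of_eval_ne_zero {σ : Type*} [Finite σ] {c : MvPolynomial σ ℂ}
    (hc : ∀ x, eval x c ≠ 0) : ∃ a : ℂ, a ≠ 0 ∧ c = C a := by
  have h := vanishingIdeal_zeroLocus_eq_radical (K := ℂ) (Ideal.span {c})
  have h0 : zeroLocus ℂ (Ideal.span {c}) = ∅ := by
    refine Set.eq_empty_of_forall_notMem fun x hx => hc x ?_
    have := hx c (Ideal.mem_span_singleton_self c)
    rwa [← RingHom.coe_coe, coe_aeval_eq_eval] at this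
  rw [h0, vanishingIdeal_empty, eq_comm, Ideal.radical_eq_top, Ideal.span_singleton_eq_top] at h
  obtain ⟨a, ha, ha'⟩ := MvPolynomial.isUnit_iff_eq_C_of_isReduced.1 h
  exact ⟨a, ha.ne_zero, ha'⟩

/-- A polynomial in several variables that is injective in the variable `z_i` is
`a * (z_i + P)` with `a` a nonzero constant and `P` independent of `z_i`. -/
lemma exists_eval_eq_of_injective (i : Fin n) (p : MvPolynomial (Fin n) ℂ)
    (hp : ∀ z : Fin n → ℂ, Function.Injective fun t => eval (Function.update z i t) p) :
    ∃ a : ℂ, a ≠ 0 ∧ ∃ P : MvPolynomial {j // j ≠ i} ℂ,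
      ∀ z, eval z p = a * (z i + aeval (fun j : {j // j ≠ i} => z j) P) := by
  -- `p` as a polynomial in `z_i` over the ring of the other variables. Every specialization has
  -- degree one, so the coefficient of `z_i` vanishes nowhere and is constant.
  let q : Polynomial (MvPolynomial {j // j ≠ i} ℂ) :=
    aeval (fun j => if h : j = i then Polynomial.X else Polynomial.C (X ⟨j, h⟩)) p
  have hq : ∀ (z : Fin n → ℂ) (t : ℂ),
      (q.map (eval fun j : {j // j ≠ i} => z j)).eval t = eval (Function.update z i t) p := by
    intro z t
    simp only [q]
    clear hp q
    induction p using MvPolynomial.induction_on with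
    | C a => simp [IsScalarTower.algebraMap_apply ℂ (MvPolynomial {j // j ≠ i} ℂ)
        (Polynomial (MvPolynomial {j // j ≠ i} ℂ))]
    | add p₁ p₂ h1 h2 => simp only [map_add, Polynomial.map_add, Polynomial.eval_add, h1, h2]
    | mul_X p₁ j h1 =>
      simp only [map_mul, Polynomial.map_mul, Polynomial.eval_mul, h1, aeval_X, eval_X]
      by_cases h : j = i
      · simp [h]
      · simp [h]
  have hdeg : ∀ z : Fin n → ℂ, (q.map (eval fun j : {j // j ≠ i} => z j)).natDegree = 1 :=
    fun z => natDegree_eq_one_of_injective (by simpa only [hq] using hp z)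
  have hc : ∀ w : {j // j ≠ i} → ℂ, eval w (q.coeff 1) ≠ 0 := by
    intro w h0
    have h1 := hdeg fun j => if h : j = i then 0 else w ⟨j, h⟩
    have e : (fun j : {j // j ≠ i} => if h : (j : Fin n) = i then 0 else w ⟨j, h⟩) = w := by
      funext j
      rw [dif_neg j.2]
    rw [e] at h1
    have h2 : (q.map (eval w)).leadingCoeff = 0 := by
      rw [Polynomial.leadingCoeff, h1, Polynomial.coeff_map, h0]
    rw [Polynomial.leadingCoeff_eq_zero] at h2
    rw [h2, Polynomial.natDegree_zero] at h1
    exact zero_ne_one h1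
  obtain ⟨a, ha, hca⟩ := exists_eq_C_of_eval_ne_zero hc
  refine ⟨a, ha, C a⁻¹ * q.coeff 0, fun z => ?_⟩
  have h1 := hq z (z i)
  rw [Function.update_eq_self, Polynomial.eq_X_add_C_of_natDegree_le_one (hdeg z).le] at h1
  rw [← h1, Polynomial.coeff_map, Polynomial.coeff_map, hca, ← RingHom.coe_coe (aeval _),
    coe_aeval_eq_eval]
  simp only [Polynomial.eval_add, Polynomial.eval_mul, Polynomial.eval_C, Polynomial.eval_X, eval_C,
    map_mul, mul_add, mul_inv_cancel_left₀ ha]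

lemma eval_update_of_mem_supported {i j : Fin n} (hij : i < j) {p : MvPolynomial (Fin n) ℂ}
    (hp : p ∈ supported ℂ (Set.Ici j)) (z : Fin n → ℂ) (t : ℂ) :
    eval (Function.update z i t) p = eval z p := by
  rw [supported_eq_range_rename] at hp
  obtain ⟨q, rfl⟩ := hp
  change eval _ (rename _ q) = eval _ (rename _ q)
  rw [eval_rename, eval_rename]
  congr 2
  funext l
  exact Function.update_of_ne (hij.trans_le l.2).ne' _ _

/-- The dilation `z_i ↦ a * z_i`. -/
def dilation (i : Fin n) {a : ℂ} (ha : a ≠ 0) : Equiv.Perm (Fin n → ℂ) where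
  toFun z := Function.update z i (a * z i)
  invFun z := Function.update z i (a⁻¹ * z i)
  left_inv z := by simp [ha]
  right_inv z := by simp [ha]

lemma dilation_mem_extGroup [NeZero n] (i : Fin n) {a : ℂ} (ha : a ≠ 0) :
    dilation i ha ∈ extGroup n := by
  refine affine_mem_extGroup ⟨Function.update X i (C a * X i), fun z j => ?_, fun j => ?_⟩
  · by_cases h : j = i
    · subst h
      simp [dilation]
    · simp [dilation, Function.update_of_ne h]
  · by_cases h : j = i
    · subst h
      rw [Function.update_self]
      exact (isHomogeneous_C_mul_X a j).totalDegree_le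
    · rw [Function.update_of_ne h, totalDegree_X]

/-- Coordinates are straightened one at a time: `k` counts those already equal to `X i`, and `m`
those remaining. At index `k` no other coordinate of `f` involves `z_k`, so injectivity of `f` makes
`p k` injective in `z_k`. It is then a dilation after a shear, which can be divided out. -/
lemma mem_extGroup_of_triangular [NeZero n] (m k : ℕ) (hmk : k + m = n) {f : Equiv.Perm (Fin n → ℂ)}
    {p : Fin n → MvPolynomial (Fin n) ℂ} (hf : IsGivenBy f p)
    (hp : ∀ i, p i ∈ supported ℂ (Set.Ici i)) (hk : ∀ i : Fin n, i.val < k → p i = X i) :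
    f ∈ extGroup n := by
  induction m generalizing k f p with
  | zero =>
    have : f = 1 := by
      ext z i
      rw [hf, hk i (by omega)]
      simp
    rw [this]
    exact one_mem _
  | succ m ih =>
    let i : Fin n := ⟨k, by omega⟩
    have hne : ∀ (j : Fin n), j ≠ i → ∀ z t, eval (Function.update z i t) (p j) = eval z (p j) := by
      intro j hj z t
      rcases lt_or_gt_of_ne hj with h | h
      · rw [hk j h, eval_X, eval_X, Function.update_of_ne hj]
      · exact eval_update_of_mem_supported h (hp j) z t
    obtain ⟨a, ha, P, hP⟩ := exists_eval_eq_of_injective i (p i) fun z s t hst => by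
      have : f (Function.update z i s) = f (Function.update z i t) := by
        funext j
        rw [hf, hf]
        by_cases hj : j = i
        · rw [hj]
          exact hst
        · rw [hne j hj, hne j hj]
      simpa using congrFun (f.injective this) i
    have hE : dilation i ha * shearPerm i P ∈ extGroup n :=
      mul_mem (dilation_mem_extGroup i ha) (shearPerm_mem_extGroup i P)
    have hEz : ∀ z, (dilation i ha * shearPerm i P) z =
        Function.update z i (a * (z i + aeval (fun j : {j // j ≠ i} => z j) P)) := fun z => by
      simp [dilation, shearPerm]
    refine (mul_mem_cancel_right (inv_mem hE)).1
      (ih (k + 1) (by omega) (p := Function.update p i (X i)) ?_ ?_ ?_)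
    · intro x j
      -- Writing the argument as the image of `z` avoids computing the inverse of the divisor.
      obtain ⟨z, rfl⟩ := (dilation i ha * shearPerm i P).surjective x
      change f ((dilation i ha * shearPerm i P).symm ((dilation i ha * shearPerm i P) z)) j = _
      rw [Equiv.symm_apply_apply, hf, hEz]
      by_cases hj : j = i
      · subst hj
        simp [hP]
      · rw [Function.update_of_ne hj, hne j hj]
    · intro j
      by_cases hj : j = i
      · subst hj
        rw [Function.update_self, X_mem_supported]
        exact Set.self_mem_Ici
      · rw [Function.update_of_ne hj]
        exact hp j
    · intro j hj
      by_cases hji : j = i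
      · subst hji
        rw [Function.update_self]
      · rw [Function.update_of_ne hji]
        have : j.val ≠ k := fun h => hji (Fin.ext h)
        exact hk j (by omega)

lemma jonquieres_mem_extGroup [NeZero n] {f : Equiv.Perm (Fin n → ℂ)} (hf : IsJonquieres f) :
    f ∈ extGroup n := by
  obtain ⟨p, hp, hs⟩ := hf
  exact mem_extGroup_of_triangular n 0 (zero_add n) hp hs fun i hi => absurd hi (Nat.not_lt_zero _)

lemma tame_le_extGroup [NeZero n] : Tame n ≤ extGroup n :=
  (Subgroup.closure_le _).2 <| by
    rintro f (hf | hf)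
    exacts [affine_mem_extGroup hf, jonquieres_mem_extGroup hf]

theorem exists_tame_embedding (n : ℕ) [NeZero n] : ∃ ι : Tame n →* G n, Function.Injective ι ∧
      ∀ f : Tame n, ((ι f : G n) : Bir n).Extends (f : Equiv.Perm (Fin n → ℂ)) := by
  have h : ∀ f : Tame n, ∃ φ : G n, (φ : Bir n).Extends (f : Equiv.Perm (Fin n → ℂ)) := fun f => by
    obtain ⟨φ, hφ, h, -⟩ := tame_le_extGroup f.2
    exact ⟨⟨φ, hφ⟩, h⟩
  choose ι hι using h
  refine ⟨MonoidHom.mk' ι fun f g => Subtype.ext ((hι (f * g)).unique ((hι f).mul (hι g))), ?_, hι⟩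
  rw [injective_iff_map_eq_one]
  intro f hf
  have h1 := hι f
  rw [show ι f = 1 from hf] at h1
  exact Subtype.ext (Equiv.ext h1.eq_id)

lemma sigma_mul_self [NeZero n] : sigma n * sigma n = 1 := mk_mul_mk_eq_one (sigma_isLeftInv n)

/-! ### The free product of cyclic groups -/

section FreeProd

variable {m : ℕ}

/-- The orders of the factors of the free product: the factor at `none` has order two, the other
factors are infinite cyclic. -/
def factorOrder (m : ℕ) (o : Option (Fin m)) : ℕ := o.elim 2 fun _ => 0

/-- The free product of `m` infinite cyclic groups and a group of order two. -/
abbrev FreeProd (m : ℕ) : Type :=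
  Monoid.CoprodI fun o : Option (Fin m) => Multiplicative (ZMod (factorOrder m o))

/-- The generators of the factors. -/
def FreeProd.gen (o : Option (Fin m)) : FreeProd m :=
  Monoid.CoprodI.of (i := o) (Multiplicative.ofAdd 1)

/-- The homomorphism from a cyclic group that sends the generator to a given element. -/
def cyclicHom {H : Type*} [Group H] {k : ℕ} {s : H} (hs : s ^ k = 1) :
    Multiplicative (ZMod k) →* H :=
  AddMonoidHom.toMultiplicativeLeft (ZMod.lift k ⟨zmultiplesHom (Additive H) (Additive.ofMul s), by
    rw [zmultiplesHom_apply, natCast_zsmul, ← ofMul_pow, hs, ofMul_one]⟩)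

lemma cyclicHom_ofAdd_intCast {H : Type*} [Group H] {k : ℕ} {s : H} (hs : s ^ k = 1) (e : ℤ) :
    cyclicHom hs (Multiplicative.ofAdd (e : ZMod k)) = s ^ e := by
  simp [cyclicHom]

lemma cyclicHom_ofAdd_one {H : Type*} [Group H] {k : ℕ} {s : H} (hs : s ^ k = 1) :
    cyclicHom hs (Multiplicative.ofAdd 1) = s := by
  simpa using cyclicHom_ofAdd_intCast hs 1

lemma exists_ofAdd_intCast {k : ℕ} (x : Multiplicative (ZMod k)) :
    ∃ e : ℤ, x = Multiplicative.ofAdd (e : ZMod k) := by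
  obtain ⟨e, he⟩ := ZMod.intCast_surjective (Multiplicative.toAdd x)
  exact ⟨e, by rw [he, ofAdd_toAdd]⟩

lemma FreeProd.of_eq_gen_zpow (o : Option (Fin m)) (e : ℤ) :
    (Monoid.CoprodI.of (i := o) (Multiplicative.ofAdd (e : ZMod (factorOrder m o))) : FreeProd m) =
      FreeProd.gen o ^ e := by
  rw [FreeProd.gen, ← map_zpow, ← ofAdd_zsmul, zsmul_one]

section Lift

variable {H : Type*} [Group H] {a : Option (Fin m) → H} (ha : ∀ o, a o ^ factorOrder m o = 1)

/-- The homomorphism from the free product that sends the generators to the elements `a o`. -/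
def FreeProd.lift : FreeProd m →* H := Monoid.CoprodI.lift fun o => cyclicHom (ha o)

@[simp] lemma FreeProd.lift_gen (o : Option (Fin m)) : FreeProd.lift ha (FreeProd.gen o) = a o := by
  rw [FreeProd.lift, FreeProd.gen, Monoid.CoprodI.lift_of, cyclicHom_ofAdd_one]

lemma FreeProd.induction {P : FreeProd m → Prop} (one : P 1) (mul : ∀ x y, P x → P y → P (x * y))
    (gen : ∀ o, P (FreeProd.gen o)) (inv : ∀ o, P (FreeProd.gen o)⁻¹) (w : FreeProd m) : P w := by
  induction w using Monoid.CoprodI.induction_on with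
  | one => exact one
  | of o x =>
    obtain ⟨e, rfl⟩ := exists_ofAdd_intCast x
    rw [FreeProd.of_eq_gen_zpow]
    induction e using Int.induction_on with
    | zero => simpa using one
    | succ k ih => rw [zpow_add_one]; exact mul _ _ ih (gen o)
    | pred k ih => rw [zpow_sub_one]; exact mul _ _ ih (inv o)
  | mul x y hx hy => exact mul _ _ hx hy

lemma FreeProd.range_lift : (FreeProd.lift ha).range = Subgroup.closure (Set.range a) := by
  apply le_antisymm
  · rintro _ ⟨w, rfl⟩
    have ha' : ∀ o, a o ∈ Subgroup.closure (Set.range a) := fun o =>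
      Subgroup.subset_closure ⟨o, rfl⟩
    induction w using FreeProd.induction with
    | one => rw [map_one]; exact one_mem _
    | mul x y hx hy => rw [map_mul]; exact mul_mem hx hy
    | gen o => rw [FreeProd.lift_gen]; exact ha' o
    | inv o => rw [map_inv, FreeProd.lift_gen]; exact inv_mem (ha' o)
  · rw [Subgroup.closure_le]
    rintro _ ⟨o, rfl⟩
    exact ⟨_, FreeProd.lift_gen ha o⟩

end Lift

instance (m : ℕ) : Countable (FreeProd m) := by
  have : Countable (FreeMonoid (Σ o : Option (Fin m), Multiplicative (ZMod (factorOrder m o)))) :=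
    have (o : Option (Fin m)) : Countable (Multiplicative (ZMod (factorOrder m o))) :=
      ZMod.intCast_surjective.countable
    inferInstanceAs (Countable (List _))
  exact Function.Surjective.countable (f := Con.mk' _) Con.mk'_surjective

/-- The elements `a_i s` of the free product freely generate a free group. -/
lemma FreeProd.lift_gen_mul_gen_injective (m : ℕ) : Function.Injective
    (FreeGroup.lift fun i : Fin m => FreeProd.gen (some i) * FreeProd.gen none) := by
  -- Killing the involution sends each product of generators to a free generator, which gives a left
  -- inverse.
  let a : Option (Fin m) → FreeGroup (Fin m) := fun o => o.elim 1 FreeGroup.of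
  have ha : ∀ o, a o ^ factorOrder m o = 1 := by
    rintro (_ | i)
    · exact one_pow 2
    · exact pow_zero _
  have h : (FreeProd.lift ha).comp
      (FreeGroup.lift fun i : Fin m => FreeProd.gen (some i) * FreeProd.gen none) =
        MonoidHom.id _ := by
    ext i
    simp [a]
  exact Function.LeftInverse.injective (DFunLike.congr_fun h)

/-- The binary free product of the factors is the free product indexed by `Option (Fin m)`. -/
def coprodEquivFreeProd (m : ℕ) :
    Monoid.Coprod (Monoid.CoprodI fun _ : Fin m => Multiplicative ℤ) (Multiplicative (ZMod 2)) ≃*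
      FreeProd m :=
  MonoidHom.toMulEquiv
    (Monoid.Coprod.lift
      (Monoid.CoprodI.lift fun i => (Monoid.CoprodI.of (i := some i)).comp
        (MonoidHom.id (Multiplicative ℤ)))
      ((Monoid.CoprodI.of (M := fun o : Option (Fin m) => Multiplicative (ZMod (factorOrder m o)))
        (i := none)).comp (MonoidHom.id (Multiplicative (ZMod 2)))))
    (Monoid.CoprodI.lift fun o => match o with
      | none => Monoid.Coprod.inr
      | some i => Monoid.Coprod.inl.comp (Monoid.CoprodI.of (M := fun _ : Fin m => Multiplicative ℤ)
          (i := i)))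
    (by
      refine Monoid.Coprod.hom_ext (Monoid.CoprodI.ext_hom _ _ fun i => ?_) ?_
      · rfl
      · rfl)
    (by
      refine Monoid.CoprodI.ext_hom _ _ fun o => ?_
      cases o <;> rfl)

end FreeProd

/-! ### Words in the generators depend polynomially on the matrices -/

/-- The entries of a family of matrices. -/
def entries {m : ℕ} (A : Fin m → Matrix (Fin (n + 1)) (Fin (n + 1)) ℂ) :
    Fin m × Fin (n + 1) × Fin (n + 1) → ℂ := fun t => A t.1 t.2.1 t.2.2

/-- A family of birational maps parametrized by tuples of invertible matrices is polynomial if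
it is represented by tuples whose coefficients are polynomials in the matrix entries. -/
def IsPolyFamily {m : ℕ} (θ : (Fin m → GL (Fin (n + 1)) ℂ) → Bir n) : Prop :=
  ∃ H : Fin (n + 1) → MvPolynomial (Fin (n + 1)) (MvPolynomial (Fin m × Fin (n + 1) × Fin (n + 1)) ℂ),
    ∀ A, ∃ F : BirTuple n, Bir.mk F = θ A ∧
      ∀ i, F.1.poly i = map (eval (entries fun l => (A l).1)) (H i)

section PolyFamily

variable {m : ℕ}

lemma IsPolyFamily.mul {θ η : (Fin m → GL (Fin (n + 1)) ℂ) → Bir n} (hθ : IsPolyFamily θ)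
    (hη : IsPolyFamily η) : IsPolyFamily fun A => θ A * η A := by
  obtain ⟨H, hH⟩ := hθ
  obtain ⟨K, hK⟩ := hη
  refine ⟨fun i => bind₁ K (H i), fun A => ?_⟩
  obtain ⟨F, hF, hF'⟩ := hH A
  obtain ⟨G, hG, hG'⟩ := hK A
  refine ⟨F.comp G, by simp only [← hF, ← hG]; rfl, fun i => ?_⟩
  change bind₁ G.1.poly (F.1.poly i) = _
  rw [map_bind₁, hF', funext hG']

lemma IsPolyFamily.one : IsPolyFamily fun _ : Fin m → GL (Fin (n + 1)) ℂ => (1 : Bir n) :=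
  ⟨X, fun _ => ⟨⟨Tuple.id n, Tuple.id n, id_isLeftInv, id_isLeftInv⟩, rfl, fun i => by
    simp [Tuple.id]⟩⟩

lemma IsPolyFamily.sigma [NeZero n] :
    IsPolyFamily fun _ : Fin m → GL (Fin (n + 1)) ℂ => Cremona.sigma n :=
  ⟨fun i => ∏ j ∈ Finset.univ.erase i, X j, fun _ =>
    ⟨⟨sigmaTuple n, sigmaTuple n, sigma_isLeftInv n, sigma_isLeftInv n⟩, rfl, fun i => by
      simp [sigmaTuple, map_prod]⟩⟩

lemma autToBir_mk (A : GL (Fin (n + 1)) ℂ) :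
    autToBir n (Matrix.ProjGenLinGroup.mk A) = glToBir n A := rfl

lemma IsPolyFamily.gl (l : Fin m) :
    IsPolyFamily fun A : Fin m → GL (Fin (n + 1)) ℂ => glToBir n (A l) :=
  ⟨fun i => ∑ j, C (X (l, i, j)) * X j, fun A => ⟨_, rfl, fun i => by
    simp [linTuple, entries]⟩⟩

lemma IsPolyFamily.gl_inv (l : Fin m) :
    IsPolyFamily fun A : Fin m → GL (Fin (n + 1)) ℂ => (glToBir n (A l))⁻¹ := by
  let N : Matrix (Fin (n + 1)) (Fin (n + 1)) (MvPolynomial (Fin m × Fin (n + 1) × Fin (n + 1)) ℂ) :=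
    Matrix.of fun i j => X (l, i, j)
  -- The adjugate is polynomial in the entries and differs from the inverse only by the scalar
  -- `det`, which is invisible projectively.
  refine ⟨fun i => ∑ j, C (N.adjugate i j) * X j, fun A => ?_⟩
  have hdet : (A l).1.det ≠ 0 := (Matrix.isUnits_det_units (A l)).ne_zero
  let B : GL (Fin (n + 1)) ℂ := Matrix.GeneralLinearGroup.mkOfDetNeZero (A l).1.adjugate (by
    rw [Matrix.det_adjugate]
    exact pow_ne_zero _ hdet)
  have hB : glToBir n B = (glToBir n (A l))⁻¹ := by
    rw [eq_inv_iff_mul_eq_one, ← map_mul]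
    have : B * A l = Matrix.GeneralLinearGroup.scalar (Fin (n + 1)) (Units.mk0 _ hdet) := by
      refine Units.ext ?_
      change (A l).1.adjugate * (A l).1 = _
      rw [Matrix.adjugate_mul, Matrix.GeneralLinearGroup.coe_scalar, Matrix.scalar_apply,
        Matrix.smul_one_eq_diagonal]
      rfl
    rw [this, ← autToBir_mk, Matrix.ProjGenLinGroup.mk_scalar, map_one]
  refine ⟨_, hB, fun i => ?_⟩
  have hN : N.adjugate.map (eval (entries fun l => (A l).1)) = (A l).1.adjugate := by
    have := RingHom.map_adjugate (eval (entries fun l => (A l).1)) N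
    rw [RingHom.mapMatrix_apply, RingHom.mapMatrix_apply] at this
    rw [this]
    congr 1
    ext i j
    simp [N, entries]
  have hN' : ∀ i j, eval (entries fun l => (A l).1) (N.adjugate i j) = (A l).1.adjugate i j :=
    fun i j => congrFun (congrFun hN i) j
  simp [linTuple, hN', B, Matrix.GeneralLinearGroup.mkOfDetNeZero]

/-- The images of the generators of the free product: the automorphisms `g i` and `σ_n`. -/
def generatorImage [NeZero n] (g : Fin m → AutP n) (o : Option (Fin m)) : Bir n :=
  o.elim (Cremona.sigma n) fun i => autToBir n (g i)

lemma generatorImage_pow [NeZero n] (g : Fin m → AutP n) (o : Option (Fin m)) :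
    generatorImage g o ^ factorOrder m o = 1 := by
  cases o with
  | none => exact (sq _).trans sigma_mul_self
  | some i => exact pow_zero _

/-- The homomorphism from the free product that sends the generators to `g i` and `σ_n`. -/
def wordHom [NeZero n] (g : Fin m → AutP n) : FreeProd m →* Bir n :=
  FreeProd.lift (generatorImage_pow g)

lemma isPolyFamily_wordHom [NeZero n] (w : FreeProd m) :
    IsPolyFamily fun A : Fin m → GL (Fin (n + 1)) ℂ =>
      wordHom (fun l => Matrix.ProjGenLinGroup.mk (A l)) w := by
  induction w using FreeProd.induction with
  | one => simpa only [map_one] using IsPolyFamily.one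
  | mul x y hx hy => simpa only [map_mul] using hx.mul hy
  | gen o =>
    simp only [wordHom, FreeProd.lift_gen]
    cases o with
    | none => exact IsPolyFamily.sigma
    | some i => exact IsPolyFamily.gl i
  | inv o =>
    simp only [wordHom, map_inv, FreeProd.lift_gen]
    cases o with
    | none =>
      have : (Cremona.sigma n)⁻¹ = Cremona.sigma n := inv_eq_of_mul_eq_one_left sigma_mul_self
      simpa only [generatorImage, Option.elim, this] using IsPolyFamily.sigma
    | some i => exact IsPolyFamily.gl_inv i

/-- A tuple `F` is the identity exactly when all `F_i X_j - F_j X_i` vanish; their coefficients are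
polynomials in the matrix entries. -/
lemma isZariskiClosed_wordHom_eq_one [NeZero n] (w : FreeProd m) :
    IsZariskiClosed {g : Fin m → AutP n | wordHom g w = 1} := by
  obtain ⟨H, hH⟩ := isPolyFamily_wordHom (n := n) w
  refine ⟨{p | ∃ i j s, p = coeff s (H i * X j - H j * X i)}, fun A => ?_⟩
  obtain ⟨F, hF, hF'⟩ := hH A
  have h1 : wordHom (fun l => Matrix.ProjGenLinGroup.mk (A l)) w = 1 ↔
      ∀ i j, F.1.poly i * X j = F.1.poly j * X i := by
    rw [show wordHom (fun l => Matrix.ProjGenLinGroup.mk (A l)) w = Bir.mk F from hF.symm]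
    exact Quotient.eq
  rw [Set.mem_ofPred_eq, h1]
  have h2 : ∀ i j, F.1.poly i * X j = F.1.poly j * X i ↔
      ∀ s, eval (entries fun l => (A l).1) (coeff s (H i * X j - H j * X i)) = 0 := by
    intro i j
    rw [← sub_eq_zero, MvPolynomial.ext_iff]
    refine forall_congr' fun s => ?_
    rw [← coeff_map, map_sub, map_mul, map_mul, map_X, map_X, hF', hF', coeff_zero]
  simp only [h2]
  constructor
  · rintro h p ⟨i, j, s, rfl⟩
    exact h i j s
  · exact fun h i j s => h _ ⟨i, j, s, rfl⟩

end PolyFamily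

/-! ### Euclidean density of the generic locus -/

section Density

/-- On the complex line from `A` to a point where `p` does not vanish, `p` is a nonzero polynomial
in one variable. Its finitely many zeros cannot isolate `A` from the nonvanishing locus. -/
lemma dense_eval_ne_zero {m : ℕ} {p : MvPolynomial (Fin m × Fin (n + 1) × Fin (n + 1)) ℂ}
    (hp : p ≠ 0) : Dense {A : Fin m → Matrix (Fin (n + 1)) (Fin (n + 1)) ℂ |
      eval (entries A) p ≠ 0} := by
  obtain ⟨x, hx⟩ : ∃ x, eval x p ≠ 0 := by
    by_contra! h
    exact hp (MvPolynomial.funext fun x => by rw [h, map_zero])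
  intro A
  let B : Fin m → Matrix (Fin (n + 1)) (Fin (n + 1)) ℂ := fun l => Matrix.of fun i j => x (l, i, j)
  let γ : ℂ → Fin m → Matrix (Fin (n + 1)) (Fin (n + 1)) ℂ := fun s => A + s • (B - A)
  have hγ : Continuous γ := continuous_const.add (continuous_id.smul continuous_const)
  let q : Polynomial ℂ := aeval (fun t => Polynomial.C (entries A t) +
    Polynomial.X * Polynomial.C (entries B t - entries A t)) p
  have hq : ∀ s, q.eval s = eval (entries (γ s)) p := by
    intro s
    rw [← Polynomial.coe_aeval_eq_eval, comp_aeval_apply, ← coe_aeval_eq_eval,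
      RingHom.coe_coe]
    congr 2
    funext t
    simp [γ, entries]
  have hq0 : q ≠ 0 := by
    intro h0
    have h1 := hq 1
    have e : entries (γ 1) = x := by
      funext t
      simp [γ, entries, B]
    rw [h0, Polynomial.eval_zero, e] at h1
    exact hx h1.symm
  have hd : Dense {s : ℂ | q.eval s ≠ 0} := by
    have : {s : ℂ | q.eval s ≠ 0} = {s | q.IsRoot s}ᶜ := rfl
    rw [this]
    exact (Polynomial.finite_setOfPred_isRoot hq0).countable.dense_compl ℂ
  have h0 : γ 0 = A := by simp [γ]
  rw [← h0]
  refine closure_mono ?_ (hγ.continuousAt.continuousWithinAt.mem_closure_image (hd 0))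
  rintro _ ⟨s, hs, rfl⟩
  rwa [Set.mem_ofPred_eq, ← hq]

lemma continuous_entries {m : ℕ} :
    Continuous (entries : (Fin m → Matrix (Fin (n + 1)) (Fin (n + 1)) ℂ) → _) :=
  continuous_pi fun t =>
    ((continuous_apply t.1).matrix_elem t.2.1 t.2.2)

instance {m : ℕ} : BaireSpace (Fin m → Matrix (Fin (n + 1)) (Fin (n + 1)) ℂ) :=
  inferInstanceAs (BaireSpace (Fin m → Fin (n + 1) → Fin (n + 1) → ℂ))

lemma isOpenMap_gl_val : IsOpenMap (Units.val : GL (Fin (n + 1)) ℂ → _) := by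
  let _ : NormedRing (Matrix (Fin (n + 1)) (Fin (n + 1)) ℂ) := Matrix.linftyOpNormedRing
  let _ : NormedAlgebra ℂ (Matrix (Fin (n + 1)) (Fin (n + 1)) ℂ) := Matrix.linftyOpNormedAlgebra
  have := FiniteDimensional.complete ℂ (Matrix (Fin (n + 1)) (Fin (n + 1)) ℂ)
  exact Units.isOpenMap_val

/-- The complement of a countable union of proper Zariski closed sets is dense. -/
lemma dense_compl_of_isZariskiClosed {m : ℕ} {R : ℕ → Set (Fin m → AutP n)}
    (hR : ∀ j, IsZariskiClosed (R j) ∧ R j ≠ Set.univ) : Dense {g | ∀ j, g ∉ R j} := by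
  have h : ∀ j, ∃ p : MvPolynomial (Fin m × Fin (n + 1) × Fin (n + 1)) ℂ, p ≠ 0 ∧
      ∀ A : Fin m → GL (Fin (n + 1)) ℂ, eval (entries fun l => (A l).1) p ≠ 0 →
        (fun l => Matrix.ProjGenLinGroup.mk (A l)) ∉ R j := by
    intro j
    obtain ⟨⟨I, hI⟩, hne⟩ := hR j
    obtain ⟨g, hg⟩ := (Set.ne_univ_iff_exists_notMem _).1 hne
    choose A hA using fun l => Matrix.ProjGenLinGroup.mk_surjective (g l)
    rw [← funext hA, hI] at hg
    push Not at hg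
    obtain ⟨p, hp, hp0⟩ := hg
    exact ⟨p, fun h => hp0 (by rw [h, map_zero]), fun B hB hmem => hB ((hI B).1 hmem p hp)⟩
  choose p hp0 hp using h
  -- Baire's theorem is applied in the space of all matrix tuples. Density then passes to invertible
  -- tuples, as they embed by an open map, and to `AutP n` by the continuous surjection.
  have hD : Dense (⋂ j, {A : Fin m → Matrix (Fin (n + 1)) (Fin (n + 1)) ℂ |
      eval (entries A) (p j) ≠ 0}) :=
    dense_iInter_of_isOpen
      (fun j => isOpen_ne_fun ((MvPolynomial.continuous_eval (p j)).comp continuous_entries)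
        continuous_const)
      fun j => dense_eval_ne_zero (hp0 j)
  have hD' := hD.preimage (IsOpenMap.piMap (f := fun (_ : Fin m) (A : GL (Fin (n + 1)) ℂ) => A.1)
    (fun _ => isOpenMap_gl_val) (by simp [Filter.cofinite_eq_bot]))
  have hc : Continuous fun (A : Fin m → GL (Fin (n + 1)) ℂ) (l : Fin m) =>
      (Matrix.ProjGenLinGroup.mk (A l) : AutP n) :=
    continuous_pi fun l => continuous_coinduced_rng.comp (continuous_apply l)
  have hs : Function.Surjective fun (A : Fin m → GL (Fin (n + 1)) ℂ) (l : Fin m) =>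
      (Matrix.ProjGenLinGroup.mk (A l) : AutP n) :=
    Matrix.ProjGenLinGroup.mk_surjective.comp_left
  refine (hs.denseRange.dense_image hc hD').mono ?_
  rintro _ ⟨A, hA, rfl⟩ j
  exact hp j A (Set.mem_iInter.1 hA j)

end Density

/-! ### Ping-pong on the diagonal line -/

/-- The vector of the point `t` of the diagonal line. -/
def diagVec (n : ℕ) (t : ℂ) : Fin (n + 1) → ℂ := chart fun _ => t

lemma diagVec_zero [NeZero n] (t : ℂ) : diagVec n t 0 = t := by
  rw [← Fin.castSucc_zero', diagVec, chart_castSucc]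

lemma diagVec_last (t : ℂ) : diagVec n t (Fin.last n) = 1 := chart_last _

/-- The linear form that vanishes on the diagonal line at `p`. -/
def diagForm (n : ℕ) (p : ℂ) : Fin (n + 1) → ℂ := Pi.single 0 1 - p • Pi.single (Fin.last n) 1

lemma diagForm_dotProduct [NeZero n] (p t : ℂ) : diagForm n p ⬝ᵥ diagVec n t = t - p := by
  simp [diagForm, sub_dotProduct, diagVec_zero, diagVec_last]

/-- A one-parameter group of transvections that acts on the diagonal line by parabolic maps
fixing `p`. -/
def parabolicHom [NeZero n] (p : ℂ) : Multiplicative ℂ →* GL (Fin (n + 1)) ℂ :=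
  MonoidHom.toHomUnits
    { toFun c := 1 + Multiplicative.toAdd c • Matrix.vecMulVec (diagVec n p) (diagForm n p)
      map_one' := by simp
      map_mul' c d := by
        have h : Matrix.vecMulVec (diagVec n p) (diagForm n p) *
            Matrix.vecMulVec (diagVec n p) (diagForm n p) = 0 := by
          rw [Matrix.vecMulVec_mul_vecMulVec, diagForm_dotProduct, sub_self, zero_smul,
            Matrix.vecMulVec_zero]
        rw [toAdd_mul, add_mul, one_mul, mul_add, mul_one, smul_mul_smul_comm, h, smul_zero,
          add_zero, add_smul, add_assoc, add_comm (_ • _)] }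

/-- In the coordinate `s = t - p` the action is `s ↦ s / (1 + c s)`. The hypothesis says that the
image is not the point at infinity of the line. -/
lemma maps_parabolic [NeZero n] (p c t : ℂ) (h : 1 + c * (t - p) ≠ 0) :
    Maps (glToBir n (parabolicHom p (Multiplicative.ofAdd c))) (diagVec n t)
      (diagVec n (p + (t - p) / (1 + c * (t - p)))) := by
  refine maps_glToBir _ h fun i => ?_
  have h1 : (parabolicHom p (Multiplicative.ofAdd c)).1.mulVec (diagVec n t) =
      diagVec n t + (c * (t - p)) • diagVec n p := by
    change (1 + c • Matrix.vecMulVec (diagVec n p) (diagForm n p)).mulVec _ = _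
    rw [Matrix.add_mulVec, Matrix.one_mulVec, Matrix.smul_mulVec, Matrix.vecMulVec_mulVec,
      diagForm_dotProduct, op_smul_eq_smul, mul_smul]
  refine (congrFun h1 i).trans ?_
  induction i using Fin.lastCases with
  | last => simp [diagVec]
  | cast i =>
    simp only [diagVec, Pi.add_apply, Pi.smul_apply, chart_castSucc, smul_eq_mul]
    field_simp
    ring

lemma maps_sigma_diagVec [NeZero n] {t : ℂ} (ht : t ≠ 0) :
    Maps (sigma n) (diagVec n t) (diagVec n t⁻¹) := by
  refine maps_sigma one_ne_zero (fun i => ?_) fun i => ?_ <;>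
  induction i using Fin.lastCases <;> simp [diagVec, ht]

section PingPong

variable {m : ℕ}

/-- The fixed points of the parabolic maps. -/
def center (i : Fin m) : ℂ := 3 * (i : ℂ) + 3

/-- The attracting regions of the factors. -/
def inner (o : Option (Fin m)) : Set ℂ := o.elim {t | ‖t‖ < 1} fun i => {t | ‖t - center i‖ < 1}

/-- The regions that the factors move into their attracting regions. -/
def outer (o : Option (Fin m)) : Set ℂ := o.elim {t | 1 < ‖t‖} fun i => {t | 1 ≤ ‖t - center i‖}

lemma norm_center (i : Fin m) : 3 ≤ ‖center i‖ := by
  have : center i = ((3 * (i : ℝ) + 3 : ℝ) : ℂ) := by simp [center]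
  rw [this, Complex.norm_real, Real.norm_of_nonneg (by positivity)]
  have : (0 : ℝ) ≤ (i : ℝ) := by positivity
  linarith

lemma norm_center_sub {i j : Fin m} (h : i ≠ j) : 3 ≤ ‖center i - center j‖ := by
  have e : center i - center j = ((3 * ((i.val : ℤ) - (j.val : ℤ) : ℤ) : ℤ) : ℂ) := by
    simp [center]
    ring
  have h1 : (1 : ℤ) ≤ |(i.val : ℤ) - (j.val : ℤ)| :=
    Int.one_le_abs (sub_ne_zero.2 fun h' => h (Fin.ext (by exact_mod_cast h')))
  rw [e, Complex.norm_intCast, ← Int.cast_abs, abs_mul]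
  have h2 : (3 : ℤ) ≤ |3| * |(i.val : ℤ) - (j.val : ℤ)| := by
    rw [abs_of_nonneg (by norm_num : (0 : ℤ) ≤ 3)]
    linarith
  exact_mod_cast h2

/-- The discs have radius one and their centres, `0` included, are at mutual distance at least `3`.
-/
lemma inner_subset_outer {o o' : Option (Fin m)} (h : o ≠ o') : inner o ⊆ outer o' := by
  intro t ht
  rcases o with _ | i <;> rcases o' with _ | j
  · exact absurd rfl h
  · have ht' : ‖t‖ < 1 := ht
    change 1 ≤ ‖t - center j‖
    have h1 := norm_center j
    have h2 := norm_sub_norm_le (center j) t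
    rw [norm_sub_rev] at h2
    linarith
  · have ht' : ‖t - center i‖ < 1 := ht
    change 1 < ‖t‖
    have h1 := norm_center i
    have h2 := norm_sub_norm_le (center i) t
    rw [norm_sub_rev] at h2
    linarith
  · have ht' : ‖t - center i‖ < 1 := ht
    change 1 ≤ ‖t - center j‖
    have h1 := norm_center_sub (i := i) (j := j) fun h' => h (congrArg some h')
    have h2 := norm_sub_le (t - center j) (t - center i)
    have e : t - center j - (t - center i) = center i - center j := by ring
    rw [e] at h2
    linarith

/-- The automorphisms of projective space that play ping-pong with `σ_n`. -/
def pingPongAut (n m : ℕ) [NeZero n] (i : Fin m) : AutP n :=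
  Matrix.ProjGenLinGroup.mk (parabolicHom (center i) (Multiplicative.ofAdd 3))

lemma autToBir_pingPongAut_zpow [NeZero n] (i : Fin m) (e : ℤ) :
    autToBir n (pingPongAut n m i) ^ e =
      glToBir n (parabolicHom (center i) (Multiplicative.ofAdd ((e : ℂ) * 3))) := by
  rw [pingPongAut, autToBir_mk, ← map_zpow, ← map_zpow, ← ofAdd_zsmul, zsmul_eq_mul]

lemma exists_maps_factor [NeZero n] (o : Option (Fin m))
    (x : Multiplicative (ZMod (factorOrder m o))) (hx : x ≠ 1) {t : ℂ} (ht : t ∈ outer o) :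
    ∃ t' ∈ inner o, Maps (wordHom (pingPongAut n m) (Monoid.CoprodI.of x))
      (diagVec n t) (diagVec n t') := by
  cases o with
  | none =>
    have ht' : 1 < ‖t‖ := ht
    have hx' : x = Multiplicative.ofAdd 1 := by
      have key : ∀ y : Multiplicative (ZMod 2), y ≠ 1 → y = Multiplicative.ofAdd 1 := by decide
      exact key x hx
    have h0 : t ≠ 0 := norm_pos_iff.1 (one_pos.trans ht')
    refine ⟨t⁻¹, ?_, ?_⟩
    · change ‖t⁻¹‖ < 1
      rw [norm_inv]
      exact inv_lt_one_of_one_lt₀ ht'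
    · have : wordHom (pingPongAut n m) (Monoid.CoprodI.of x) = sigma n := by
        rw [hx']
        exact FreeProd.lift_gen _ none
      rw [this]
      exact maps_sigma_diagVec h0
  | some i =>
    have ht' : 1 ≤ ‖t - center i‖ := ht
    obtain ⟨e, hxe⟩ := exists_ofAdd_intCast x
    have he : e ≠ 0 := by
      intro h0
      rw [h0, Int.cast_zero, ofAdd_zero] at hxe
      exact hx hxe
    have he' : (1 : ℝ) ≤ ‖(e : ℂ)‖ := by
      rw [Complex.norm_intCast]
      exact_mod_cast Int.one_le_abs he
    set s := t - center i with hs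
    -- As `‖s‖ ≥ 1`, the bound `3‖s‖ - 1` exceeds `‖s‖`. The parameter `3` thus makes every nonzero
    -- power contract the exterior of the disc into its interior.
    have h1 : 3 * ‖s‖ - 1 ≤ ‖1 + (e : ℂ) * 3 * s‖ := by
      have h2 := norm_sub_norm_le ((e : ℂ) * 3 * s) (-1)
      rw [sub_neg_eq_add, add_comm, norm_neg, norm_one, norm_mul, norm_mul] at h2
      have h3 : ‖(3 : ℂ)‖ = 3 := by simp
      rw [h3] at h2
      nlinarith [norm_nonneg s]
    have hpos : ‖s‖ < ‖1 + (e : ℂ) * 3 * s‖ := by linarith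
    have hne : 1 + (e : ℂ) * 3 * s ≠ 0 := norm_pos_iff.1 ((norm_nonneg s).trans_lt hpos)
    refine ⟨center i + s / (1 + (e : ℂ) * 3 * s), ?_, ?_⟩
    · change ‖center i + s / (1 + (e : ℂ) * 3 * s) - center i‖ < 1
      rw [add_sub_cancel_left, norm_div, div_lt_one ((norm_nonneg s).trans_lt hpos)]
      exact hpos
    · rw [hxe, FreeProd.of_eq_gen_zpow, map_zpow, wordHom, FreeProd.lift_gen]
      change Maps (autToBir n (pingPongAut n m i) ^ e) _ _
      rw [autToBir_pingPongAut_zpow]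
      exact maps_parabolic _ _ _ hne

lemma exists_maps_neWord [NeZero n] {o o' : Option (Fin m)}
    (w : Monoid.CoprodI.NeWord (fun o => Multiplicative (ZMod (factorOrder m o))) o o') {t : ℂ}
    (ht : t ∈ outer o') : ∃ t' ∈ inner o, Maps (wordHom (pingPongAut n m) w.prod)
      (diagVec n t) (diagVec n t') := by
  induction w generalizing t with
  | singleton x hx =>
    rw [Monoid.CoprodI.NeWord.prod_singleton]
    exact exists_maps_factor _ x hx ht
  | append w₁ hne w₂ ih₁ ih₂ =>
    obtain ⟨t', ht', h'⟩ := ih₂ ht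
    obtain ⟨t'', ht'', h''⟩ := ih₁ (inner_subset_outer hne.symm ht')
    refine ⟨t'', ht'', ?_⟩
    rw [Monoid.CoprodI.NeWord.append_prod, map_mul]
    exact h''.mul h'

/-- The base point for ping-pong: every nontrivial reduced word moves it into some inner disc, hence
moves it. -/
lemma neg_two_mem_outer (o : Option (Fin m)) : (-2 : ℂ) ∈ outer o ∧ (-2 : ℂ) ∉ inner o := by
  cases o with
  | none =>
    change 1 < ‖(-2 : ℂ)‖ ∧ ¬ ‖(-2 : ℂ)‖ < 1
    norm_num
  | some i =>
    change 1 ≤ ‖-2 - center i‖ ∧ ¬ ‖-2 - center i‖ < 1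
    have e : -2 - center i = ((-(3 * (i : ℝ) + 5) : ℝ) : ℂ) := by
      simp only [center]
      push_cast
      ring
    have h0 : (0 : ℝ) ≤ (i : ℝ) := by positivity
    have h1 : 1 ≤ ‖-2 - center i‖ := by
      rw [e, Complex.norm_real, norm_neg, Real.norm_of_nonneg (by positivity)]
      linarith
    exact ⟨h1, not_lt.2 h1⟩

lemma wordHom_pingPongAut_ne_one [NeZero n] {w : FreeProd m} (hw : w ≠ 1) :
    wordHom (pingPongAut n m) w ≠ 1 := by
  classical
  intro h
  have hw' : Monoid.CoprodI.Word.equiv w ≠ Monoid.CoprodI.Word.empty := fun h0 => hw <| by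
    rw [← Monoid.CoprodI.Word.equiv.symm_apply_apply w, h0]
    exact Monoid.CoprodI.Word.prod_empty
  obtain ⟨o, o', w', h'⟩ := Monoid.CoprodI.NeWord.of_word _ hw'
  have hprod : w'.prod = w := by
    rw [Monoid.CoprodI.NeWord.prod, h']
    exact Monoid.CoprodI.Word.equiv.symm_apply_apply w
  obtain ⟨t, ht, hm⟩ := exists_maps_neWord (n := n) w' (neg_two_mem_outer o').1
  rw [hprod, h] at hm
  have := hm.one_proportional 0 (Fin.last n)
  rw [diagVec_zero, diagVec_last, diagVec_last, diagVec_zero, mul_one, one_mul] at this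
  exact (neg_two_mem_outer o).2 (this ▸ ht)

end PingPong

/-! ### Generic freeness -/

lemma isGeneric_wordHom_injective (n m : ℕ) [NeZero n] :
    IsGeneric fun g : Fin m → AutP n => Function.Injective (wordHom g) := by
  -- Enumerating the nontrivial words by `ℕ` requires at least one; the involution serves even when
  -- `m = 0`.
  have hne : Nonempty {w : FreeProd m // w ≠ 1} := by
    refine ⟨⟨FreeProd.gen none, fun h => ?_⟩⟩
    have := Monoid.CoprodI.of_injective
      (M := fun o : Option (Fin m) => Multiplicative (ZMod (factorOrder m o))) none
      (h.trans (map_one _).symm)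
    have h2 : (Multiplicative.ofAdd 1 : Multiplicative (ZMod 2)) ≠ 1 := by decide
    exact h2 this
  obtain ⟨w, hw⟩ := exists_surjective_nat {w : FreeProd m // w ≠ 1}
  have hR : ∀ j, IsZariskiClosed {g : Fin m → AutP n | wordHom g (w j).1 = 1} ∧
      {g : Fin m → AutP n | wordHom g (w j).1 = 1} ≠ Set.univ := fun j =>
    ⟨isZariskiClosed_wordHom_eq_one _, fun h =>
      wordHom_pingPongAut_ne_one (n := n) (w j).2 (Set.eq_univ_iff_forall.1 h (pingPongAut n m))⟩
  refine ⟨_, hR, dense_compl_of_isZariskiClosed hR, fun g hg => (injective_iff_map_eq_one _).2 fun x hx => ?_⟩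
  by_contra h1
  obtain ⟨j, hj⟩ := hw ⟨x, h1⟩
  exact hg j (by rw [hj]; exact hx)

lemma range_generatorImage [NeZero n] {m : ℕ} (g : Fin m → AutP n) :
    Set.range (generatorImage g) = Set.range (fun i => autToBir n (g i)) ∪ {sigma n} := by
  ext φ
  constructor
  · rintro ⟨_ | i, rfl⟩
    exacts [Or.inr rfl, Or.inl ⟨i, rfl⟩]
  · rintro (⟨i, rfl⟩ | rfl)
    exacts [⟨some i, rfl⟩, ⟨none, rfl⟩]

end Cremona

end

open Cremona in
theorem propositionB (n : ℕ) [NeZero n] :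
    (∃ ι : Tame n →* G n, Function.Injective ι ∧
      ∀ f : Tame n, ((ι f : G n) : Bir n).Extends (f : Equiv.Perm (Fin n → ℂ))) ∧
    ∀ k : ℕ, IsGeneric fun g : Fin (k + 1) → AutP n =>
      (∃ e : Monoid.Coprod (Monoid.CoprodI fun _ : Fin (k + 1) => Multiplicative ℤ)
            (Multiplicative (ZMod 2)) ≃*
          Subgroup.closure (Set.range (fun i => autToBir n (g i)) ∪ {sigma n}),
        (∀ i, (e (Monoid.Coprod.inl (Monoid.CoprodI.of (i := i) (Multiplicative.ofAdd 1))) : Bir n)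
          = autToBir n (g i)) ∧
        (e (Monoid.Coprod.inr (Multiplicative.ofAdd 1)) : Bir n) = sigma n) ∧
      Subgroup.closure (Set.range fun i => autToBir n (g i) * sigma n) ≤ G n ∧
      ∃ e : FreeGroup (Fin (k + 1)) ≃*
          Subgroup.closure (Set.range fun i => autToBir n (g i) * sigma n),
        ∀ i, (e (FreeGroup.of i) : Bir n) = autToBir n (g i) * sigma n := by
  refine ⟨exists_tame_embedding n, fun k => ?_⟩
  obtain ⟨R, hR, hd, h⟩ := isGeneric_wordHom_injective n (k + 1)
  refine ⟨R, hR, hd, fun g hg => ?_⟩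
  have hinj := h g hg
  have hrange : (wordHom g).range =
      Subgroup.closure (Set.range (fun i => autToBir n (g i)) ∪ {sigma n}) := by
    rw [wordHom, FreeProd.range_lift, range_generatorImage]
  refine ⟨⟨(coprodEquivFreeProd (k + 1)).trans
    ((MonoidHom.ofInjective hinj).trans (MulEquiv.subgroupCongr hrange)), fun i => ?_, ?_⟩, ?_, ?_⟩
  · exact FreeProd.lift_gen (generatorImage_pow g) (some i)
  · exact FreeProd.lift_gen (generatorImage_pow g) none
  · rw [Subgroup.closure_le]
    rintro _ ⟨i, rfl⟩
    exact mul_mem (Subgroup.subset_closure (Or.inr ⟨g i, rfl⟩)) sigma_mem_G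
  · have hfree : (wordHom g).comp (FreeGroup.lift fun i : Fin (k + 1) =>
        FreeProd.gen (some i) * FreeProd.gen none) =
          FreeGroup.lift fun i => autToBir n (g i) * sigma n := by
      ext i
      simp only [MonoidHom.comp_apply, FreeGroup.lift_apply_of, map_mul, wordHom, FreeProd.lift_gen]
      rfl
    have hinj' : Function.Injective
        (FreeGroup.lift fun i : Fin (k + 1) => autToBir n (g i) * sigma n) := by
      rw [← hfree]
      exact hinj.comp (FreeProd.lift_gen_mul_gen_injective (k + 1))
    refine ⟨(MonoidHom.ofInjective hinj').trans
      (MulEquiv.subgroupCongr FreeGroup.range_lift_eq_closure), fun i => ?_⟩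
    exact FreeGroup.lift_apply_of
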